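/- Let $c_1,c_2,\lambda,t>0$. Let $N=\{N(s)\}_{s\ge0}$ be a homogeneous Poisson process of rate $\lambda$, i.e. $N(s)=\#\{n\ge1: W_1+\dots+W_n\le s\}$ with $W_1,W_2,\dots$ independent exponential random variables of parameter $\lambda$, and let $V(0)$ be independent of $(W_n)_{n\ge1}$ with $P\{V(0)=c_1\}=P\{V(0)=-c_2\}=\tfrac12$. Let $V(s)$ switch between $c_1$ and $-c_2$ at each event of $N$ (so $V(s)=V(0)$ if $N(s)$ is even, and $V(s)$ is the other of the two velocities if $N(s)$ is odd), and let $\mathcal T(s)=\int_0^sV(u)\,du$, $s\ge0$, be the asymmetric telegraph process. For integer $r\ge 1$ let $I_r(x)=\sum_{j=0}^\infty\left(\frac x2\right)^{2j+r}\frac1{j!\,\Gamma(j+r+1)}$. Then for every $\beta\in[0,c_1t)$ $$P\Big\{\max_{0\le s\le t}\mathcal T(s)<\beta\ \Big|\ V(0)=c_1\Big\}=e^{-\lambda t}\sum_{r=1}^\infty I_r\Big(\tfrac{2\lambda}{c_1+c_2}\sqrt{(c_1t-\beta)(c_2t+\beta)}\Big)\left[\left(\sqrt{\tfrac{c_2t+\beta}{c_1t-\beta}}\right)^r-\left(\tfrac{c_2}{c_1}\sqrt{\tfrac{c_1t-\beta}{c_2t+\beta}}\right)^r\right],$$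 where the series over $r$ converges. At $\beta=c_1t$ the formula holds with its right-hand side read as the limit for $\beta\uparrow c_1t$: this limit exists and equals $$P\Big\{\max_{0\le s\le t}\mathcal T(s)<c_1t\ \Big|\ V(0)=c_1\Big\}=1-e^{-\lambda t}.$$ Moreover, $$P\Big\{\max_{0\le s\le t}\mathcal T(s)=c_1t\ \Big|\ V(0)=c_1\Big\}=e^{-\lambda t}.$$ -/

import Mathlib

open MeasureTheory ProbabilityTheory Filter Topology

noncomputable section

/-- The modified Bessel function of the first kind (Bessel function with imaginary argument)
of integer order `r`. -/
def besselI (r : ℕ) (x : ℝ) : ℝ :=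
  ∑' j : ℕ, (x / 2) ^ (2 * j + r) / ((Nat.factorial j : ℝ) * Real.Gamma ((j : ℝ) + (r : ℝ) + 1))

namespace Telegraph

variable {Ω : Type*}

/-- The instant of the `n`-th event (`n ≥ 1` events, `T₀ = 0`), when the successive waiting times
are `W 0, W 1, …`. -/
def eventTime (W : ℕ → Ω → ℝ) (n : ℕ) (ω : Ω) : ℝ := ∑ i ∈ Finset.range n, W i ω

/-- The number `N(s)` of events in `(0, s]`. (The set is almost surely finite when the waiting
times are those of a Poisson process.) -/
def eventCount (W : ℕ → Ω → ℝ) (s : ℝ) (ω : Ω) : ℕ :=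
  Set.ncard {n : ℕ | 1 ≤ n ∧ eventTime W n ω ≤ s}

/-- The velocity `V(s)`: it equals `V(0)` when the number of events up to time `s` is even, and
the other one of the two velocities `c₁`, `-c₂` when that number is odd. -/
def velocity (c₁ c₂ : ℝ) (V₀ : Ω → ℝ) (W : ℕ → Ω → ℝ) (s : ℝ) (ω : Ω) : ℝ :=
  if Even (eventCount W s ω) then V₀ ω else if V₀ ω = c₁ then -c₂ else c₁

/-- The position at time `s` of a particle that starts from the origin. -/
def position (c₁ c₂ : ℝ) (V₀ : Ω → ℝ) (W : ℕ → Ω → ℝ) (s : ℝ) (ω : Ω) : ℝ :=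
  ∫ u in (0 : ℝ)..s, velocity c₁ c₂ V₀ W u ω

/-- The maximum of the position over `[0, t]`. (For every `ω` the velocity is a bounded measurable
function of time, so the path is continuous and the supremum is attained.) -/
def runningMax (c₁ c₂ : ℝ) (V₀ : Ω → ℝ) (W : ℕ → Ω → ℝ) (t : ℝ) (ω : Ω) : ℝ :=
  sSup ((fun s => position c₁ c₂ V₀ W s ω) '' Set.Icc 0 t)

/-- The waiting times of a homogeneous Poisson process of rate `lam`: independent exponential
random variables with parameter `lam`. -/
structure IsPoissonWaiting [MeasurableSpace Ω] (P : Measure Ω) (lam : ℝ)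
    (W : ℕ → Ω → ℝ) : Prop where
  measurable : ∀ n, Measurable (W n)
  law : ∀ n, P.map (W n) = expMeasure lam
  indep : iIndepFun W P

/-- The data `V₀ = V(0)` and `W` drive an asymmetric telegraph process: the changes of direction
are paced by a homogeneous Poisson process of rate `lam` with waiting times `W`, and the initial
velocity is `c₁` or `-c₂` with equal probability, independently of the Poisson process. -/
structure IsTelegraph [MeasurableSpace Ω] (P : Measure Ω) (c₁ c₂ lam : ℝ)
    (V₀ : Ω → ℝ) (W : ℕ → Ω → ℝ) : Prop where
  waiting : IsPoissonWaiting P lam W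
  measurable_V₀ : Measurable V₀
  prob_pos : P {ω | V₀ ω = c₁} = 1 / 2
  prob_neg : P {ω | V₀ ω = -c₂} = 1 / 2
  indep : IndepFun V₀ (fun ω n => W n ω) P

/-- The general term, of index `r`, of the Bessel series for the law of the maximum. -/
def besselTerm (c₁ c₂ lam t β : ℝ) (r : ℕ) : ℝ :=
  besselI r (2 * lam / (c₁ + c₂) * √((c₁ * t - β) * (c₂ * t + β))) *
    ((√((c₂ * t + β) / (c₁ * t - β))) ^ r -
      (c₂ / c₁ * √((c₁ * t - β) / (c₂ * t + β))) ^ r)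

end Telegraph

end

/-! Let U and D be `exp (lam * t)` times the probabilities that a path starting upward, respectively
downward, stays below `β` up to time `t`. Use the coordinates x = `downTime`, y = `upTime`, with x +
y = t. An upward move of length a fixes x and lowers y by a; a downward move lowers x and fixes y.
Conditioning on the first switch gives two renewal equations (`stayProb_up_eq`, `stayProb_down_eq`),
the integral form of ∂U/∂y = λD, ∂D/∂x = λU, with U = 0 on the line y = (c₂/c₁)x (that is, β = 0)
and D = exp(λy) at x = 0.

A double power series solves this system. The equations force its coefficients to be constant along
parallels to the diagonal, the condition at x = 0 fixes them above the diagonal, and the condition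
on the line fixes them below by antisymmetry (`upGF_diag`). Summing along these parallels produces
the Bessel functions (`hasSum_besselI`).

For uniqueness, the difference of two solutions satisfies the homogeneous renewal equations;
iterating them n times bounds it by M(λt)^n/n!, which tends to 0 (`error_le`). At β = c₁t one has x
= 0, where the series reduces to exp(λt) - 1; this gives the limit and the atom. -/

noncomputable section

/-! ### Exponential generating functions in one and two variables. -/

/-- If `|d k| ≤ K R ^ k`, the exponential generating function of `d` can be differentiated
termwise: its derivative is the exponential generating function of the shifted sequence. -/
lemma hasDerivAt_tsum_egf {d : ℕ → ℝ} {K R : ℝ} (hd : ∀ k, |d k| ≤ K * R ^ k) (hR : 0 ≤ R)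
    (b : ℝ) :
    HasDerivAt (fun z : ℝ => ∑' k : ℕ, d k * (z ^ k / (k.factorial : ℝ)))
      (∑' k : ℕ, d (k + 1) * (b ^ k / (k.factorial : ℝ))) b := by
  have hK : 0 ≤ K := by simpa using (abs_nonneg _).trans (hd 0)
  set B : ℝ := |b| + 1 with hB
  have hB0 : 0 ≤ B := by positivity
  have hterm : ∀ (k : ℕ) (z : ℝ), |z| ≤ B →
      ‖d (k + 1) * (z ^ k / (k.factorial : ℝ))‖ ≤ K * R * ((R * B) ^ k / (k.factorial : ℝ)) := by
    intro k z hz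
    rw [Real.norm_eq_abs, abs_mul, abs_div, abs_pow, Nat.abs_cast]
    calc |d (k + 1)| * (|z| ^ k / k.factorial)
        ≤ (K * R ^ (k + 1)) * (B ^ k / k.factorial) := by
          gcongr
          exact hd _
      _ = _ := by rw [mul_pow]; ring
  have hsum : Summable (fun k : ℕ => K * R * ((R * B) ^ k / (k.factorial : ℝ))) :=
    (Real.summable_pow_div_factorial _).mul_left _
  -- Differentiation lowers the index by one, so the majorant and the derivatives get a leading zero
  -- to stay aligned with the original terms.
  let u : ℕ → ℝ := fun k => Nat.casesOn k 0 (fun k => K * R * ((R * B) ^ k / (k.factorial : ℝ)))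
  have hu : Summable u := by
    rw [← summable_nat_add_iff 1]
    exact hsum
  let g' : ℕ → ℝ → ℝ := fun k z =>
    Nat.casesOn k 0 (fun k => d (k + 1) * (z ^ k / (k.factorial : ℝ)))
  have hder : HasDerivAt (fun z : ℝ => ∑' k : ℕ, d k * (z ^ k / (k.factorial : ℝ)))
      (∑' k : ℕ, g' k b) b := by
    refine hasDerivAt_tsum_of_isPreconnected (t := Metric.ball (0 : ℝ) B) (y₀ := 0) hu
      Metric.isOpen_ball (convex_ball (0 : ℝ) B).isPreconnected ?_ ?_ ?_ ?_ ?_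
    · intro k z _
      cases k with
      | zero => simpa [g'] using hasDerivAt_const z (d 0)
      | succ k =>
        have h := ((hasDerivAt_pow (k + 1) z).div_const ((k + 1).factorial : ℝ)).const_mul
          (d (k + 1))
        refine h.congr_deriv ?_
        rw [Nat.factorial_succ]
        simp only [g', Nat.add_sub_cancel]
        have : ((k : ℝ) + 1) ≠ 0 := by positivity
        push_cast
        field_simp
    · intro k z hz
      cases k with
      | zero => simp [g', u]
      | succ k =>
        exact hterm k z (by simpa using (Metric.mem_ball.1 hz).le)
    · simp only [Metric.mem_ball, dist_self]; positivity
    · refine summable_of_ne_finset_zero (s := {0}) ?_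
      intro k hk
      simp at hk
      simp [hk]
    · simp [hB]
  have hs : Summable (fun k => g' k b) := by
    rw [← summable_nat_add_iff 1]
    exact Summable.of_norm_bounded hsum (fun k => hterm k b (by simp [hB]))
  rw [hs.tsum_eq_zero_add] at hder
  simpa [g'] using hder

/-- The exponential generating function of a double sequence. -/
def egf (C : ℕ → ℕ → ℝ) (a b : ℝ) : ℝ :=
  ∑' p : ℕ × ℕ, C p.1 p.2 * (a ^ p.1 / (p.1.factorial : ℝ) * (b ^ p.2 / (p.2.factorial : ℝ)))

section egf

variable {C : ℕ → ℕ → ℝ} {R : ℝ}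

lemma summable_egf_bound (R A B : ℝ) :
    Summable fun p : ℕ × ℕ => (R * A) ^ p.1 / (p.1.factorial : ℝ) *
      (B ^ p.2 / (p.2.factorial : ℝ)) :=
  summable_mul_of_summable_norm (Real.summable_pow_div_factorial _).norm
    (Real.summable_pow_div_factorial _).norm

lemma norm_egf_term_le (hC : ∀ j k, |C j k| ≤ R ^ j) {a b A B : ℝ} (ha : |a| ≤ A)
    (hb : |b| ≤ B) (p : ℕ × ℕ) :
    ‖C p.1 p.2 * (a ^ p.1 / (p.1.factorial : ℝ) * (b ^ p.2 / (p.2.factorial : ℝ)))‖ ≤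
      (R * A) ^ p.1 / (p.1.factorial : ℝ) * (B ^ p.2 / (p.2.factorial : ℝ)) := by
  have h0 : 0 ≤ R ^ p.1 := (abs_nonneg _).trans (hC p.1 p.2)
  have hA : 0 ≤ A := (abs_nonneg a).trans ha
  rw [Real.norm_eq_abs, abs_mul, abs_mul, abs_div, abs_div, abs_pow, abs_pow, Nat.abs_cast,
    Nat.abs_cast]
  calc _ ≤ R ^ p.1 * (A ^ p.1 / (p.1.factorial : ℝ) * (B ^ p.2 / (p.2.factorial : ℝ))) := by
        gcongr
        exact hC _ _
    _ = _ := by rw [mul_pow]; ring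

lemma summable_egf (hC : ∀ j k, |C j k| ≤ R ^ j) (a b : ℝ) :
    Summable fun p : ℕ × ℕ =>
      C p.1 p.2 * (a ^ p.1 / (p.1.factorial : ℝ) * (b ^ p.2 / (p.2.factorial : ℝ))) :=
  Summable.of_norm_bounded (summable_egf_bound R |a| |b|)
    (norm_egf_term_le hC le_rfl le_rfl)

lemma hasDerivAt_egf_left (hC : ∀ j k, |C j k| ≤ R ^ j) (hR : 0 ≤ R) (a b : ℝ) :
    HasDerivAt (fun z => egf C z b) (egf (fun j k => C (j + 1) k) a b) a := by
  -- Summing over the second index first leaves a one-variable series in `z`. The factor `T`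
  -- accommodates the shifted coefficients, bounded by `R * R ^ j`.
  have key : ∀ (D : ℕ → ℕ → ℝ) (S T : ℝ), (∀ j k, |D j k| ≤ T * S ^ j) → ∀ z,
      egf D z b =
        ∑' j : ℕ, (∑' k : ℕ, D j k * (b ^ k / (k.factorial : ℝ))) * (z ^ j / (j.factorial : ℝ)) := by
    intro D S T hD z
    have hs : Summable fun p : ℕ × ℕ =>
        D p.1 p.2 * (z ^ p.1 / (p.1.factorial : ℝ) * (b ^ p.2 / (p.2.factorial : ℝ))) := by
      refine Summable.of_norm_bounded ((summable_egf_bound S |z| |b|).mul_left T) fun p => ?_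
      have h0 : 0 ≤ T * S ^ p.1 := (abs_nonneg _).trans (hD p.1 p.2)
      rw [Real.norm_eq_abs, abs_mul, abs_mul, abs_div, abs_div, abs_pow, abs_pow, Nat.abs_cast,
        Nat.abs_cast]
      calc _ ≤ T * S ^ p.1 *
            (|z| ^ p.1 / (p.1.factorial : ℝ) * (|b| ^ p.2 / (p.2.factorial : ℝ))) := by
            gcongr
            exact hD _ _
        _ = _ := by rw [mul_pow]; ring
    rw [egf, hs.tsum_prod]
    refine tsum_congr fun j => ?_
    rw [← tsum_mul_right]
    exact tsum_congr fun k => by ring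
  have hbound : ∀ j, |∑' k : ℕ, C j k * (b ^ k / (k.factorial : ℝ))| ≤
      (∑' k : ℕ, |b| ^ k / (k.factorial : ℝ)) * R ^ j := by
    intro j
    rw [← Real.norm_eq_abs, ← tsum_mul_right]
    refine tsum_of_norm_bounded ((Real.summable_pow_div_factorial |b|).mul_right _).hasSum
      fun k => ?_
    rw [Real.norm_eq_abs, abs_mul, abs_div, abs_pow, Nat.abs_cast, mul_comm]
    gcongr
    exact hC j k
  have h := hasDerivAt_tsum_egf hbound hR a
  rw [key (fun j k => C (j + 1) k) R R (fun j k => by simpa [pow_succ'] using hC (j + 1) k)]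
  exact h.congr_of_eventuallyEq (Eventually.of_forall fun z => key C R 1 (by simpa using hC) z)

lemma hasDerivAt_egf_right (hC : ∀ j k, |C j k| ≤ R ^ j) (a b : ℝ) :
    HasDerivAt (fun z => egf C a z) (egf (fun j k => C j (k + 1)) a b) b := by
  have key : ∀ (D : ℕ → ℕ → ℝ), (∀ j k, |D j k| ≤ R ^ j) → ∀ z,
      egf D a z =
        ∑' k : ℕ, (∑' j : ℕ, D j k * (a ^ j / (j.factorial : ℝ))) * (z ^ k / (k.factorial : ℝ)) := by
    intro D hD z
    have hs := summable_egf hD a z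
    refine hs.tsum_prod.trans ((Summable.tsum_comm (f := fun j k =>
      D j k * (a ^ j / (j.factorial : ℝ) * (z ^ k / (k.factorial : ℝ)))) hs).symm.trans ?_)
    refine tsum_congr fun k => ?_
    rw [← tsum_mul_right]
    exact tsum_congr fun j => by ring
  have hbound : ∀ k, |∑' j : ℕ, C j k * (a ^ j / (j.factorial : ℝ))| ≤
      (∑' j : ℕ, (R * |a|) ^ j / (j.factorial : ℝ)) * 1 ^ k := by
    intro k
    rw [← Real.norm_eq_abs, one_pow, mul_one]
    refine tsum_of_norm_bounded (Real.summable_pow_div_factorial _).hasSum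
      fun j => ?_
    rw [Real.norm_eq_abs, abs_mul, abs_div, abs_pow, Nat.abs_cast, mul_pow, mul_div_assoc]
    gcongr
    exact hC j k
  have h := hasDerivAt_tsum_egf hbound zero_le_one b
  rw [key (fun j k => C j (k + 1)) (fun j k => hC j (k + 1))]
  exact h.congr_of_eventuallyEq (Eventually.of_forall fun z => key C hC z)

lemma continuous_egf (hC : ∀ j k, |C j k| ≤ R ^ j) :
    Continuous fun q : ℝ × ℝ => egf C q.1 q.2 := by
  rw [continuous_iff_continuousAt]
  intro q
  unfold ContinuousAt egf
  refine tendsto_tsum_of_dominated_convergence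
    (summable_egf_bound R (|q.1| + 1) (|q.2| + 1)) (fun p => ?_) ?_
  · exact Continuous.tendsto (by fun_prop) q
  · have h1 : ∀ᶠ z : ℝ × ℝ in 𝓝 q, |z.1| < |q.1| + 1 :=
      (continuous_fst.abs.tendsto q).eventually (gt_mem_nhds (by simp))
    have h2 : ∀ᶠ z : ℝ × ℝ in 𝓝 q, |z.2| < |q.2| + 1 :=
      (continuous_snd.abs.tendsto q).eventually (gt_mem_nhds (by simp))
    filter_upwards [h1, h2] with z hz1 hz2 p
    exact norm_egf_term_le hC hz1.le hz2.le p

end egf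

namespace Telegraph

/-! ### The double series solving the differential system and its boundary conditions. -/

/-- The coefficients of the double series `upGF`. -/
def upCoeff (ρ : ℝ) (j k : ℕ) : ℝ := if j < k then 1 else if j = k then 0 else -ρ ^ (j - k)

lemma abs_upCoeff_le {ρ : ℝ} (hρ : 0 ≤ ρ) (j k : ℕ) : |upCoeff ρ j k| ≤ (max 1 ρ) ^ j := by
  have h1 : (1 : ℝ) ≤ max 1 ρ := le_max_left _ _
  have h2 : (1 : ℝ) ≤ max 1 ρ ^ j := one_le_pow₀ h1
  unfold upCoeff
  split_ifs
  · simpa using h2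
  · simp
  · rw [abs_neg, abs_of_nonneg (by positivity)]
    calc ρ ^ (j - k) ≤ (max 1 ρ) ^ (j - k) := by gcongr; exact le_max_right _ _
      _ ≤ _ := pow_le_pow_right₀ h1 (Nat.sub_le _ _)

/-- Differentiating once in each variable thus reproduces the series, which is what couples `upGF`
and `downGF`. -/
lemma upCoeff_succ_succ (ρ : ℝ) (j k : ℕ) : upCoeff ρ (j + 1) (k + 1) = upCoeff ρ j k := by
  simp [upCoeff]

/-- The generating function that governs a path with upward initial velocity. -/
def upGF (ρ a b : ℝ) : ℝ := egf (upCoeff ρ) a b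

/-- The generating function that governs a path with downward initial velocity. -/
def downGF (ρ a b : ℝ) : ℝ := egf (fun j k => upCoeff ρ j (k + 1)) a b

section GF

variable {ρ : ℝ}

lemma hasDerivAt_upGF (hρ : 0 ≤ ρ) (a b : ℝ) :
    HasDerivAt (fun z => upGF ρ a z) (downGF ρ a b) b :=
  hasDerivAt_egf_right (abs_upCoeff_le hρ) a b

lemma hasDerivAt_downGF (hρ : 0 ≤ ρ) (a b : ℝ) :
    HasDerivAt (fun z => downGF ρ z b) (upGF ρ a b) a := by
  have h := hasDerivAt_egf_left (C := fun j k => upCoeff ρ j (k + 1))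
    (fun j k => abs_upCoeff_le hρ j (k + 1)) (zero_le_one.trans (le_max_left _ _)) a b
  simp only [upCoeff_succ_succ] at h
  exact h

lemma continuous_upGF (hρ : 0 ≤ ρ) : Continuous fun q : ℝ × ℝ => upGF ρ q.1 q.2 :=
  continuous_egf (abs_upCoeff_le hρ)

lemma continuous_downGF (hρ : 0 ≤ ρ) : Continuous fun q : ℝ × ℝ => downGF ρ q.1 q.2 :=
  continuous_egf fun j k => abs_upCoeff_le hρ j (k + 1)

/-- On this line the weighted coefficient `upCoeff ρ j k * ρ ^ k` is antisymmetric in `j` and `k`,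
so exchanging the indices changes the sign of the sum. -/
lemma upGF_diag (a : ℝ) : upGF ρ a (ρ * a) = 0 := by
  have h : upGF ρ a (ρ * a) = -upGF ρ a (ρ * a) := by
    have hswap : ∀ F : ℕ × ℕ → ℝ, ∑' p : ℕ × ℕ, F p = ∑' p : ℕ × ℕ, F (p.2, p.1) := fun F =>
      ((Equiv.prodComm ℕ ℕ).tsum_eq F).symm
    conv_lhs => rw [upGF, egf, hswap]
    rw [upGF, egf, ← tsum_neg]
    refine tsum_congr fun ⟨j, k⟩ => ?_
    simp only [upCoeff, mul_pow]
    rcases lt_trichotomy j k with h | h | h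
    · rw [if_pos h, if_neg h.not_gt, if_neg h.ne']
      have : ρ ^ k = ρ ^ (k - j) * ρ ^ j := by rw [← pow_add, Nat.sub_add_cancel h.le]
      rw [this]; ring
    · simp [h]
    · rw [if_pos h, if_neg h.not_gt, if_neg h.ne']
      have : ρ ^ j = ρ ^ (j - k) * ρ ^ k := by rw [← pow_add, Nat.sub_add_cancel h.le]
      rw [this]; ring
  linarith

lemma egf_zero_left (C : ℕ → ℕ → ℝ) (b : ℝ) :
    egf C 0 b = ∑' k : ℕ, C 0 k * (b ^ k / (k.factorial : ℝ)) := by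
  have hi : Function.Injective (fun k : ℕ => ((0, k) : ℕ × ℕ)) := fun _ _ h => by simpa using h
  rw [egf, ← hi.tsum_eq]
  · simp
  · intro p hp
    refine ⟨p.2, ?_⟩
    by_contra hne
    have : p.1 ≠ 0 := fun h => hne (Prod.ext h.symm rfl)
    simp [this] at hp

lemma downGF_zero_left (b : ℝ) : downGF ρ 0 b = Real.exp b := by
  rw [downGF, egf_zero_left, Real.exp_eq_exp_ℝ, NormedSpace.exp_eq_tsum_div]
  simp [upCoeff]

lemma upGF_zero_left (hρ : 0 ≤ ρ) (b : ℝ) : upGF ρ 0 b = Real.exp b - 1 := by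
  rw [upGF, egf_zero_left, Real.exp_eq_exp_ℝ, NormedSpace.exp_eq_tsum_div]
  beta_reduce
  have hs : Summable fun k : ℕ => upCoeff ρ 0 k * (b ^ k / (k.factorial : ℝ)) := by
    refine Summable.of_norm_bounded (Real.summable_pow_div_factorial |b|) fun k => ?_
    rw [Real.norm_eq_abs, abs_mul, abs_div, abs_pow, Nat.abs_cast]
    exact mul_le_of_le_one_left (by positivity) (by simpa using abs_upCoeff_le hρ 0 k)
  rw [hs.tsum_eq_zero_add, (Real.summable_pow_div_factorial b).tsum_eq_zero_add]
  simp [upCoeff]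

end GF

/-! ### Bessel functions as sums along parallels to the diagonal. -/

lemma besselI_mul_pow {s t : ℝ} (hs : 0 < s) (r : ℕ) :
    besselI r (2 * (s * t)) * (t / s) ^ r =
      ∑' j : ℕ, (s ^ 2) ^ j / (j.factorial : ℝ) * ((t ^ 2) ^ (j + r) / ((j + r).factorial : ℝ)) := by
  rw [besselI, ← tsum_mul_right]
  refine tsum_congr fun j => ?_
  have hG : Real.Gamma ((j : ℝ) + r + 1) = ((j + r).factorial : ℝ) := by
    rw [← Real.Gamma_nat_eq_factorial]; push_cast; rfl
  rw [hG, mul_div_cancel_left₀ _ two_ne_zero, mul_pow, div_pow, div_mul_div_comm,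
    div_mul_div_comm, div_eq_div_iff (by positivity) (by positivity)]
  ring

/-- Summation of a double series with zero diagonal along the parallels to the diagonal. -/
lemma hasSum_off_diagonal {T : ℕ × ℕ → ℝ} (hT : Summable T) (hdiag : ∀ j, T (j, j) = 0) :
    HasSum (fun n : ℕ => (∑' j : ℕ, T (j, j + (n + 1))) + ∑' j : ℕ, T (j + (n + 1), j))
      (∑' p, T p) := by
  -- The first component is the distance to the diagonal minus one, the second the position along
  -- the parallel; the two summands cover the two sides.
  let e : (ℕ × ℕ) ⊕ (ℕ × ℕ) → ℕ × ℕ :=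
    Sum.elim (fun p => (p.2, p.2 + (p.1 + 1))) (fun p => (p.2 + (p.1 + 1), p.2))
  have he : Function.Injective e := by
    rintro (⟨n, j⟩ | ⟨n, j⟩) (⟨m, i⟩ | ⟨m, i⟩) h <;> simp [e] at h ⊢ <;> omega
  have hsupp : Function.support T ⊆ Set.range e := by
    rintro ⟨j, k⟩ hp
    rcases lt_trichotomy j k with h | h | h
    · exact ⟨Sum.inl (k - j - 1, j), by simp [e]; omega⟩
    · subst h
      exact absurd (hdiag j) hp
    · exact ⟨Sum.inr (j - k - 1, k), by simp [e]; omega⟩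
  have htot : HasSum (T ∘ e) (∑' p, T p) :=
    (he.hasSum_iff fun x hx => by_contra fun h => hx (hsupp h)).2 hT.hasSum
  have h1 : Summable (fun p : ℕ × ℕ => T (p.2, p.2 + (p.1 + 1))) :=
    hT.comp_injective (he.comp Sum.inl_injective)
  have h2 : Summable (fun p : ℕ × ℕ => T (p.2 + (p.1 + 1), p.2)) :=
    hT.comp_injective (he.comp Sum.inr_injective)
  have hadd : ∑' p : ℕ × ℕ, T (p.2, p.2 + (p.1 + 1)) + ∑' p : ℕ × ℕ, T (p.2 + (p.1 + 1), p.2) =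
      ∑' p, T p :=
    (HasSum.sum (f := T ∘ e) h1.hasSum h2.hasSum).unique htot
  rw [← hadd]
  exact (h1.hasSum.prod_fiberwise fun n => (h1.prod_factor n).hasSum).add
    (h2.hasSum.prod_fiberwise fun n => (h2.prod_factor n).hasSum)

/-- The Bessel series sums up to the generating function `upGF`. -/
lemma hasSum_besselI {ρ s t : ℝ} (hρ : 0 ≤ ρ) (hs : 0 < s) (ht : 0 < t) :
    HasSum (fun n : ℕ => besselI (n + 1) (2 * (s * t)) *
      ((t / s) ^ (n + 1) - (ρ * (s / t)) ^ (n + 1))) (upGF ρ (s ^ 2) (t ^ 2)) := by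
  have h := hasSum_off_diagonal (summable_egf (abs_upCoeff_le hρ) (s ^ 2) (t ^ 2))
    (fun j => by simp [upCoeff])
  rw [upGF, egf]
  convert h using 2 with n
  -- The argument of the Bessel function is symmetric in `s` and `t`, so the subtracted power is
  -- handled by the same identity with the two exchanged.
  rw [mul_sub, besselI_mul_pow hs, mul_pow, mul_left_comm, mul_comm s t,
    besselI_mul_pow ht, sub_eq_add_neg, ← neg_mul, ← tsum_mul_left]
  congr 1
  · refine tsum_congr fun j => ?_
    simp [upCoeff]
  · refine tsum_congr fun j => ?_
    have h1 : ¬ j + (n + 1) < j := by omega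
    have h2 : ¬ j + (n + 1) = j := by omega
    have h3 : j + (n + 1) - j = n + 1 := by omega
    simp only [upCoeff, if_neg h1, if_neg h2, h3]
    ring

/-! ### Deterministic zigzag paths and measurability. -/

/-- The number of events in `(0, s]` for the deterministic sequence `w` of waiting times. -/
def jumpCount (w : ℕ → ℝ) (s : ℝ) : ℕ := Set.ncard {n : ℕ | 1 ≤ n ∧ ∑ i ∈ Finset.range n, w i ≤ s}

/-- The path that starts from the origin and has alternately the velocities `a` and `b`, beginning
with `a`, and the successive switching times prescribed by the waiting times `w`. -/
def zigzag (a b : ℝ) (w : ℕ → ℝ) (s : ℝ) : ℝ :=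
  ∫ u in (0 : ℝ)..s, if Even (jumpCount w u) then a else b

/-- The waiting times for which the path stays below `β` during `[0, t]`. -/
def staysBelow (a b t β : ℝ) : Set (ℕ → ℝ) := {w | ∀ s ∈ Set.Icc 0 t, zigzag a b w s < β}

lemma measurable_jumpCount : Measurable fun p : (ℕ → ℝ) × ℝ => jumpCount p.1 p.2 := by
  have hS : ∀ n : ℕ, MeasurableSet {p : (ℕ → ℝ) × ℝ | 1 ≤ n ∧ ∑ i ∈ Finset.range n, p.1 i ≤ p.2} :=
    fun n => (MeasurableSet.const _).inter (measurableSet_le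
      (Finset.measurable_fun_sum _ fun i _ => (measurable_pi_apply i).comp measurable_fst)
      measurable_snd)
  have h1 : Measurable fun p : (ℕ → ℝ) × ℝ => ∑' n : ℕ,
      Set.indicator {p : (ℕ → ℝ) × ℝ | 1 ≤ n ∧ ∑ i ∈ Finset.range n, p.1 i ≤ p.2}
        (fun _ => (1 : ENNReal)) p :=
    Measurable.tsum fun n => measurable_const.indicator (hS n)
  have h2 : ∀ p : (ℕ → ℝ) × ℝ, ∑' n : ℕ,
      Set.indicator {p : (ℕ → ℝ) × ℝ | 1 ≤ n ∧ ∑ i ∈ Finset.range n, p.1 i ≤ p.2}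
        (fun _ => (1 : ENNReal)) p =
      ({n : ℕ | 1 ≤ n ∧ ∑ i ∈ Finset.range n, p.1 i ≤ p.2}.encard : ENNReal) := by
    intro p
    rw [← ENNReal.tsum_set_one, tsum_subtype _ (fun _ => (1 : ENNReal))]
    rfl
  simp only [h2] at h1
  have h3 : Measurable fun p : (ℕ → ℝ) × ℝ => (jumpCount p.1 p.2 : ℝ) := by
    -- For an infinite set both conventions agree: `ncard` is 0 and `toReal` sends `⊤` to 0.
    convert h1.ennreal_toReal using 2 with p
    rw [jumpCount, Set.ncard]
    cases h : Set.encard {n : ℕ | 1 ≤ n ∧ ∑ i ∈ Finset.range n, p.1 i ≤ p.2} <;> simp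
  refine measurable_to_countable' fun k => ?_
  have : (fun p : (ℕ → ℝ) × ℝ => jumpCount p.1 p.2) ⁻¹' {k} =
      (fun p : (ℕ → ℝ) × ℝ => (jumpCount p.1 p.2 : ℝ)) ⁻¹' {(k : ℝ)} := by
    ext p; simp
  rw [this]
  exact h3 (measurableSet_singleton _)

lemma measurable_zigzag_velocity (a b : ℝ) :
    Measurable fun p : (ℕ → ℝ) × ℝ => if Even (jumpCount p.1 p.2) then a else b :=
  Measurable.ite (measurable_jumpCount (MeasurableSet.of_discrete (s := {n | Even n})))
    measurable_const measurable_const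

lemma intervalIntegrable_zigzag_velocity (a b : ℝ) (w : ℕ → ℝ) (x y : ℝ) :
    IntervalIntegrable (fun u => if Even (jumpCount w u) then a else b) volume x y := by
  refine (intervalIntegrable_const (c := max |a| |b|)).mono_fun'
    ((measurable_zigzag_velocity a b).comp measurable_prodMk_left).aestronglyMeasurable
    (Eventually.of_forall fun u => ?_)
  simp only [Real.norm_eq_abs]
  split_ifs
  · exact le_max_left _ _
  · exact le_max_right _ _

lemma continuous_zigzag (a b : ℝ) (w : ℕ → ℝ) : Continuous (zigzag a b w) :=
  intervalIntegral.continuous_primitive (intervalIntegrable_zigzag_velocity a b w) 0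

@[simp] lemma zigzag_zero (a b : ℝ) (w : ℕ → ℝ) : zigzag a b w 0 = 0 := by simp [zigzag]

lemma zigzag_le {a b : ℝ} (hab : b ≤ a) (w : ℕ → ℝ) {s : ℝ} (hs : 0 ≤ s) :
    zigzag a b w s ≤ a * s := by
  have h := intervalIntegral.integral_mono_on hs (intervalIntegrable_zigzag_velocity a b w 0 s)
    (intervalIntegrable_const (c := a)) (fun u _ => by split_ifs <;> simp [hab])
  rw [intervalIntegral.integral_const, smul_eq_mul, sub_zero, mul_comm] at h
  exact h

lemma measurable_zigzag (a b : ℝ) {s : ℝ} (hs : 0 ≤ s) : Measurable fun w => zigzag a b w s := by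
  simp only [zigzag, intervalIntegral.integral_of_le hs]
  exact ((measurable_zigzag_velocity a b).stronglyMeasurable.integral_prod_right'
    (ν := volume.restrict (Set.Ioc 0 s))).measurable

/-- By compactness a continuous path below `β` stays below it by some margin `1 / (k + 1)`, and by
density this margin need only be tested at rationals projected to `[0, t]`. -/
lemma measurableSet_staysBelow (a b : ℝ) {t : ℝ} (ht : 0 ≤ t) (β : ℝ) :
    MeasurableSet (staysBelow a b t β) := by
  have h : staysBelow a b t β = ⋃ k : ℕ, ⋂ q : ℚ,
      {w | zigzag a b w (Set.projIcc 0 t ht q) ≤ β - 1 / ((k : ℝ) + 1)} := by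
    ext w
    simp only [staysBelow, Set.mem_ofPred_eq, Set.mem_iUnion, Set.mem_iInter]
    constructor
    · intro hw
      obtain ⟨s, hs, hmax⟩ := isCompact_Icc.exists_isMaxOn (Set.nonempty_Icc.2 ht)
        (continuous_zigzag a b w).continuousOn
      obtain ⟨k, hk⟩ := exists_nat_one_div_lt (sub_pos.2 (hw s hs))
      refine ⟨k, fun q => (hmax (Set.projIcc 0 t ht q).2).trans ?_⟩
      linarith
    · rintro ⟨k, hk⟩ s hs
      have hk' : ∀ x : ℝ, zigzag a b w (Set.projIcc 0 t ht x) ≤ β - 1 / ((k : ℝ) + 1) := by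
        refine fun x => Rat.denseRange_cast.induction_on x ?_ hk
        exact isClosed_le ((continuous_zigzag a b w).comp
          (continuous_subtype_val.comp continuous_projIcc)) continuous_const
      have h1 := hk' s
      rw [Set.projIcc_of_mem ht hs] at h1
      have : 0 < 1 / ((k : ℝ) + 1) := by positivity
      simp only at h1
      linarith
  rw [h]
  exact MeasurableSet.iUnion fun k => MeasurableSet.iInter fun q =>
    measurableSet_le (measurable_zigzag a b (Set.projIcc 0 t ht q).2.1) measurable_const

/-! ### Splitting a path at its first switch. -/

/-- Waiting times are admissible if they are nonnegative and have finitely many events in every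
bounded interval. -/
def Admissible (w : ℕ → ℝ) : Prop :=
  (∀ n, 0 ≤ w n) ∧ ∀ s : ℝ, {n : ℕ | ∑ i ∈ Finset.range n, w i ≤ s}.Finite

/-- The sequence `x, w 0, w 1, …`. -/
def consSeq (x : ℝ) (w : ℕ → ℝ) (n : ℕ) : ℝ := Nat.casesOn n x w

@[simp] lemma consSeq_zero (x : ℝ) (w : ℕ → ℝ) : consSeq x w 0 = x := rfl

@[simp] lemma consSeq_succ (x : ℝ) (w : ℕ → ℝ) (n : ℕ) : consSeq x w (n + 1) = w n := rfl

lemma sum_range_succ_consSeq (x : ℝ) (w : ℕ → ℝ) (n : ℕ) :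
    ∑ i ∈ Finset.range (n + 1), consSeq x w i = x + ∑ i ∈ Finset.range n, w i := by
  rw [Finset.sum_range_succ', add_comm]; simp

lemma jumpCount_consSeq_of_lt {w : ℕ → ℝ} (hw : Admissible w) {x s : ℝ} (hs : s < x) :
    jumpCount (consSeq x w) s = 0 := by
  have : {n : ℕ | 1 ≤ n ∧ ∑ i ∈ Finset.range n, consSeq x w i ≤ s} = ∅ := by
    refine Set.eq_empty_of_forall_notMem fun n hn => ?_
    obtain ⟨m, rfl⟩ := Nat.exists_eq_succ_of_ne_zero (Nat.one_le_iff_ne_zero.1 hn.1)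
    have h := hn.2
    rw [sum_range_succ_consSeq] at h
    have := Finset.sum_nonneg (s := Finset.range m) (f := w) fun i _ => hw.1 i
    linarith
  rw [jumpCount, this, Set.ncard_empty]

lemma jumpCount_consSeq_of_le {w : ℕ → ℝ} (hw : Admissible w) {x s : ℝ} (hs : x ≤ s) :
    jumpCount (consSeq x w) s = jumpCount w (s - x) + 1 := by
  have h1 : {n : ℕ | 1 ≤ n ∧ ∑ i ∈ Finset.range n, consSeq x w i ≤ s} =
      Nat.succ '' {n : ℕ | ∑ i ∈ Finset.range n, w i ≤ s - x} := by
    ext n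
    constructor
    · rintro ⟨hn, h⟩
      obtain ⟨m, rfl⟩ := Nat.exists_eq_succ_of_ne_zero (Nat.one_le_iff_ne_zero.1 hn)
      rw [sum_range_succ_consSeq] at h
      exact ⟨m, by simp only [Set.mem_ofPred_eq]; linarith, rfl⟩
    · rintro ⟨m, hm, rfl⟩
      simp only [Set.mem_ofPred_eq] at hm
      exact ⟨by simp, by rw [sum_range_succ_consSeq]; linarith⟩
  -- The index 0 of the remaining sequence stands for the switch at `x`. Finiteness is needed below,
  -- since `ncard` of an infinite set would not grow by one.
  have h2 : {n : ℕ | ∑ i ∈ Finset.range n, w i ≤ s - x} =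
      insert 0 {n : ℕ | 1 ≤ n ∧ ∑ i ∈ Finset.range n, w i ≤ s - x} := by
    ext n
    rcases n with _ | n
    · simpa using hs
    · simp
  rw [jumpCount, h1, Set.ncard_image_of_injective _ Nat.succ_injective, h2,
    Set.ncard_insert_of_notMem (by simp) ((hw.2 _).subset fun n hn => hn.2), jumpCount]

lemma zigzag_consSeq_of_le {w : ℕ → ℝ} (hw : Admissible w) (a b : ℝ) {x s : ℝ} (h0 : 0 ≤ s)
    (hs : s ≤ x) : zigzag a b (consSeq x w) s = a * s := by
  rw [zigzag, intervalIntegral.integral_of_le h0, integral_Ioc_eq_integral_Ioo,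
    setIntegral_congr_fun (g := fun _ => a) measurableSet_Ioo]
  · simp [h0, mul_comm]
  · intro u hu
    simp [jumpCount_consSeq_of_lt hw (hu.2.trans_le hs)]

lemma zigzag_consSeq {w : ℕ → ℝ} (hw : Admissible w) (a b : ℝ) {x s : ℝ} (h0 : 0 ≤ x)
    (hs : x ≤ s) : zigzag a b (consSeq x w) s = a * x + zigzag b a w (s - x) := by
  rw [← zigzag_consSeq_of_le hw a b h0 le_rfl]
  rw [zigzag, ← intervalIntegral.integral_add_adjacent_intervals
    (intervalIntegrable_zigzag_velocity a b _ 0 x) (intervalIntegrable_zigzag_velocity a b _ x s)]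
  congr 1
  have : zigzag b a w (s - x) =
      ∫ u in x..s, if Even (jumpCount w (u - x)) then b else a := by
    rw [zigzag, intervalIntegral.integral_comp_sub_right
      (fun u => if Even (jumpCount w u) then b else a) x, sub_self]
  rw [this]
  refine intervalIntegral.integral_congr fun u hu => ?_
  rw [Set.uIcc_of_le hs] at hu
  simp only [jumpCount_consSeq_of_le hw hu.1, Nat.even_add_one, ite_not]

lemma consSeq_mem_staysBelow_up_of_lt {w : ℕ → ℝ} (hw : Admissible w) {a b t β x : ℝ}
    (ha : 0 ≤ a) (ht : 0 ≤ t) (hx : t < x) :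
    consSeq x w ∈ staysBelow a b t β ↔ a * t < β := by
  constructor
  · intro h
    have := h t ⟨ht, le_rfl⟩
    rwa [zigzag_consSeq_of_le hw a b ht hx.le] at this
  · intro h s hs
    rw [zigzag_consSeq_of_le hw a b hs.1 (hs.2.trans hx.le)]
    exact (mul_le_mul_of_nonneg_left hs.2 ha).trans_lt h

lemma consSeq_mem_staysBelow_down_of_lt {w : ℕ → ℝ} (hw : Admissible w) {a b t β x : ℝ}
    (ha : a ≤ 0) (hβ : 0 < β) (hx : t < x) :
    consSeq x w ∈ staysBelow a b t β := by
  intro s hs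
  rw [zigzag_consSeq_of_le hw a b hs.1 (hs.2.trans hx.le)]
  exact (mul_nonpos_of_nonpos_of_nonneg ha hs.1).trans_lt hβ

/-- The first, ascending piece is highest at its end `x`; the rest is a path with exchanged
velocities and the level lowered by `a * x`. -/
lemma consSeq_mem_staysBelow_up {w : ℕ → ℝ} (hw : Admissible w) {a b t β x : ℝ}
    (ha : 0 ≤ a) (hx0 : 0 ≤ x) (hx : x ≤ t) :
    consSeq x w ∈ staysBelow a b t β ↔ a * x < β ∧ w ∈ staysBelow b a (t - x) (β - a * x) := by
  constructor
  · intro h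
    refine ⟨?_, fun s hs => ?_⟩
    · have := h x ⟨hx0, hx⟩
      rwa [zigzag_consSeq_of_le hw a b hx0 le_rfl] at this
    · have := h (x + s) ⟨by linarith [hs.1], by linarith [hs.2]⟩
      rw [zigzag_consSeq hw a b hx0 (by linarith [hs.1]), add_sub_cancel_left] at this
      linarith
  · rintro ⟨h1, h2⟩ s hs
    rcases le_total s x with h | h
    · rw [zigzag_consSeq_of_le hw a b hs.1 h]
      exact (mul_le_mul_of_nonneg_left h ha).trans_lt h1
    · rw [zigzag_consSeq hw a b hx0 h]
      have := h2 (s - x) ⟨by linarith, by linarith [hs.2]⟩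
      linarith

/-- The first piece never rises above 0 < `β`, so it imposes no condition. -/
lemma consSeq_mem_staysBelow_down {w : ℕ → ℝ} (hw : Admissible w) {a b t β x : ℝ}
    (ha : a ≤ 0) (hβ : 0 < β) (hx0 : 0 ≤ x) :
    consSeq x w ∈ staysBelow a b t β ↔ w ∈ staysBelow b a (t - x) (β - a * x) := by
  constructor
  · intro h s hs
    have := h (x + s) ⟨by linarith [hs.1], by linarith [hs.2]⟩
    rw [zigzag_consSeq hw a b hx0 (by linarith [hs.1]), add_sub_cancel_left] at this
    linarith
  · intro h2 s hs
    rcases le_total s x with h | h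
    · rw [zigzag_consSeq_of_le hw a b hs.1 h]
      exact (mul_nonpos_of_nonpos_of_nonneg ha hs.1).trans_lt hβ
    · rw [zigzag_consSeq hw a b hx0 h]
      have := h2 (s - x) ⟨by linarith, by linarith [hs.2]⟩
      linarith

/-! ### Conditioning on the first waiting time; almost sure admissibility. -/

section

variable {ν : Measure ℝ} [IsProbabilityMeasure ν]

lemma measurable_consSeq : Measurable fun p : ℝ × (ℕ → ℝ) => consSeq p.1 p.2 := by
  refine measurable_pi_iff.2 fun n => ?_
  cases n with
  | zero => exact measurable_fst
  | succ n => exact (measurable_pi_apply n).comp measurable_snd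

lemma map_consSeq_prod_infinitePi :
    (ν.prod (Measure.infinitePi fun _ : ℕ => ν)).map (fun p => consSeq p.1 p.2) =
      Measure.infinitePi fun _ : ℕ => ν := by
  refine Measure.eq_infinitePi _ fun s t ht => ?_
  classical
  -- Boxes determine the product measure. Enlarging the index set to an initial segment, with full
  -- factors, lets coordinate 0 be split off.
  obtain ⟨N, hN⟩ : ∃ N, s ⊆ Finset.range (N + 1) :=
    ⟨s.sup id, fun i hi => Finset.mem_range.2 (Nat.lt_succ_of_le (Finset.le_sup (f := id) hi))⟩
  let t' : ℕ → Set ℝ := fun n => if n ∈ s then t n else Set.univ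
  have ht' : ∀ n, MeasurableSet (t' n) := fun n => by
    by_cases h : n ∈ s <;> simp [t', h, ht n]
  have hpi : (s : Set ℕ).pi t = (Finset.range (N + 1) : Set ℕ).pi t' := by
    ext w
    simp only [Set.mem_pi, Finset.mem_coe, t']
    refine ⟨fun h i _ => ?_, fun h i hi => ?_⟩
    · by_cases hi : i ∈ s
      · simpa [hi] using h i hi
      · simp [hi]
    · simpa [hi] using h i (hN hi)
  have hprod : ∏ i ∈ s, ν (t i) = ∏ i ∈ Finset.range (N + 1), ν (t' i) := by
    rw [← Finset.prod_subset hN fun i _ hi => by simp [t', hi]]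
    exact Finset.prod_congr rfl fun i hi => by simp [t', hi]
  have hpre : (fun p : ℝ × (ℕ → ℝ) => consSeq p.1 p.2) ⁻¹'
      (Finset.range (N + 1) : Set ℕ).pi t' =
      t' 0 ×ˢ (Finset.range N : Set ℕ).pi fun i => t' (i + 1) := by
    ext ⟨x, w⟩
    simp only [Set.mem_preimage, Set.mem_pi, Finset.coe_range, Set.mem_Iio, Set.mem_prod]
    refine ⟨fun h => ⟨h 0 (by omega), fun i hi => h (i + 1) (by omega)⟩, fun h i hi => ?_⟩
    cases i with
    | zero => exact h.1
    | succ i => exact h.2 i (by omega)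
  rw [hpi, Measure.map_apply measurable_consSeq
    (MeasurableSet.pi (Finset.countable_toSet _) fun i _ => ht' i), hpre, Measure.prod_prod,
    Measure.infinitePi_pi _ fun i _ => ht' (i + 1), hprod, Finset.prod_range_succ', mul_comm]

lemma measurable_measureReal_consSeq {B : Set (ℕ → ℝ)} (hB : MeasurableSet B) :
    Measurable fun x => (Measure.infinitePi fun _ : ℕ => ν).real {w | consSeq x w ∈ B} :=
  (measurable_measure_prodMk_left (measurable_consSeq hB)).ennreal_toReal

/-- Conditioning on the first waiting time. -/
lemma infinitePi_real_eq_integral {B : Set (ℕ → ℝ)} (hB : MeasurableSet B) :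
    (Measure.infinitePi fun _ : ℕ => ν).real B =
      ∫ x, (Measure.infinitePi fun _ : ℕ => ν).real {w | consSeq x w ∈ B} ∂ν := by
  have hm : Measurable fun x => (Measure.infinitePi fun _ : ℕ => ν) {w | consSeq x w ∈ B} :=
    measurable_measure_prodMk_left (measurable_consSeq hB)
  simp only [measureReal_def]
  rw [integral_toReal hm.aemeasurable
    (Eventually.of_forall fun x => measure_lt_top _ _)]
  conv_lhs => rw [← map_consSeq_prod_infinitePi]
  rw [Measure.map_apply measurable_consSeq hB, Measure.prod_apply (measurable_consSeq hB)]
  rfl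

lemma admissible_of_frequently {w : ℕ → ℝ} (h0 : ∀ n, 0 ≤ w n)
    (h1 : ∃ᶠ n in atTop, 1 ≤ w n) : Admissible w := by
  refine ⟨h0, fun s => ?_⟩
  have hmono : Monotone fun n => ∑ i ∈ Finset.range n, w i := by
    refine monotone_nat_of_le_succ fun n => ?_
    rw [Finset.sum_range_succ]
    linarith [h0 n]
  have key : ∀ m : ℕ, ∃ n, (m : ℝ) ≤ ∑ i ∈ Finset.range n, w i := by
    intro m
    induction m with
    | zero => exact ⟨0, by simp⟩
    | succ m ih =>
      obtain ⟨n, hn⟩ := ih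
      obtain ⟨k, hk, hk1⟩ := (frequently_atTop.1 h1) n
      refine ⟨k + 1, ?_⟩
      have := hmono hk
      rw [Finset.sum_range_succ]
      push_cast
      simp only at this
      linarith
  obtain ⟨m, hm⟩ := exists_nat_gt s
  obtain ⟨n, hn⟩ := key m
  refine (Set.finite_Iio n).subset fun k hk => ?_
  by_contra hkn
  have := hmono (not_lt.1 hkn)
  simp only [Set.mem_ofPred_eq] at hk this
  linarith

/-- The second Borel–Cantelli lemma yields infinitely many waiting times of length at least 1, so
the partial sums diverge. -/
lemma ae_admissible (h0 : ν (Set.Iio 0) = 0) (h1 : ν (Set.Ici 1) ≠ 0) :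
    ∀ᵐ w ∂(Measure.infinitePi fun _ : ℕ => ν), Admissible w := by
  have hpos : ∀ᵐ w ∂(Measure.infinitePi fun _ : ℕ => ν), ∀ n, 0 ≤ w n := by
    refine ae_all_iff.2 fun n => ?_
    have : ∀ᵐ x ∂ν, 0 ≤ x := by
      rw [ae_iff]
      convert h0 using 2
      ext x; simp
    exact (measurePreserving_eval_infinitePi (fun _ : ℕ => ν) n).quasiMeasurePreserving.ae this
  have hind : iIndepSet (fun n : ℕ => {w : ℕ → ℝ | 1 ≤ w n})
      (Measure.infinitePi fun _ : ℕ => ν) := by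
    rw [iIndepSet_iff_meas_biInter fun n => measurableSet_le measurable_const
      (measurable_pi_apply n)]
    intro s
    have hs : (⋂ i ∈ s, {w : ℕ → ℝ | 1 ≤ w i}) = (s : Set ℕ).pi fun _ => Set.Ici 1 := by
      ext w; simp [Set.mem_pi]
    rw [hs, Measure.infinitePi_pi _ fun _ _ => measurableSet_Ici]
    refine Finset.prod_congr rfl fun i _ => ?_
    exact ((measurePreserving_eval_infinitePi (fun _ : ℕ => ν) i).measure_preimage
      measurableSet_Ici.nullMeasurableSet).symm
  have hfreq := measure_limsup_eq_one (fun n => measurableSet_le measurable_const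
      (measurable_pi_apply n)) hind (by
    have : ∀ n : ℕ, (Measure.infinitePi fun _ : ℕ => ν) {w : ℕ → ℝ | 1 ≤ w n} =
        ν (Set.Ici 1) := fun n =>
      (measurePreserving_eval_infinitePi (fun _ : ℕ => ν) n).measure_preimage
        measurableSet_Ici.nullMeasurableSet
    simp only [this]
    exact ENNReal.tsum_const_eq_top_of_ne_zero h1)
  have hfreq' : ∀ᵐ w ∂(Measure.infinitePi fun _ : ℕ => ν),
      w ∈ limsup (fun n : ℕ => {w : ℕ → ℝ | 1 ≤ w n}) atTop := by
    refine (prob_compl_eq_zero_iff₀ ?_).2 hfreq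
    exact (MeasurableSet.measurableSet_limsup fun n => measurableSet_le measurable_const
      (measurable_pi_apply n)).nullMeasurableSet
  filter_upwards [hpos, hfreq'] with w hw0 hw1
  exact admissible_of_frequently hw0 (mem_limsup_iff_frequently_mem.1 hw1)

end

/-! ### Exponential waiting times and the probability of staying below a level. -/

/-- The joint law of the waiting times of a Poisson process of rate `lam`. -/
def waitingLaw (lam : ℝ) : Measure (ℕ → ℝ) := Measure.infinitePi fun _ : ℕ => expMeasure lam

lemma isProbabilityMeasure_waitingLaw {lam : ℝ} (hlam : 0 < lam) :
    IsProbabilityMeasure (waitingLaw lam) := by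
  have := isProbabilityMeasure_expMeasure hlam
  unfold waitingLaw
  infer_instance

lemma integral_expMeasure {lam : ℝ} (hlam : 0 < lam) (h : ℝ → ℝ) :
    ∫ x, h x ∂(expMeasure lam) = ∫ x in Set.Ioi 0, lam * Real.exp (-(lam * x)) * h x := by
  have h1 : expMeasure lam = volume.withDensity (exponentialPDF lam) := rfl
  have h2 : ∀ x, (exponentialPDF lam x).toReal • h x =
      (Set.Ici 0).indicator (fun x => lam * Real.exp (-(lam * x)) * h x) x := by
    intro x
    rw [exponentialPDF_eq]
    by_cases hx : 0 ≤ x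
    · rw [if_pos hx, Set.indicator_of_mem (Set.mem_Ici.2 hx), ENNReal.toReal_ofReal (by positivity),
        smul_eq_mul]
    · simp [hx]
  have h3 : Measurable (exponentialPDF lam) :=
    (measurable_exponentialPDFReal lam).ennreal_ofReal
  rw [h1, integral_withDensity_eq_integral_toReal_smul h3
    (Eventually.of_forall fun x => ENNReal.ofReal_lt_top)]
  simp only [h2]
  rw [integral_indicator measurableSet_Ici, integral_Ici_eq_integral_Ioi]

lemma ae_admissible_waitingLaw {lam : ℝ} (hlam : 0 < lam) :
    ∀ᵐ w ∂(waitingLaw lam), Admissible w := by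
  have := isProbabilityMeasure_expMeasure hlam
  refine ae_admissible ?_ ?_
  · have h1 : expMeasure lam = volume.withDensity (exponentialPDF lam) := rfl
    rw [h1, withDensity_apply _ measurableSet_Iio]
    exact lintegral_exponentialPDF_of_nonpos le_rfl
  · intro h
    have h2 : (expMeasure lam).real (Set.Iio 1) = 1 := by
      rw [measureReal_def, (prob_compl_eq_zero_iff (measurableSet_Iio (a := (1 : ℝ)))).1
        (by rwa [Set.compl_Iio]), ENNReal.toReal_one]
    have h3 := cdf_expMeasure_eq hlam 1
    rw [cdf_eq_real, if_pos zero_le_one] at h3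
    have h4 := measureReal_mono (μ := expMeasure lam) (Set.Iio_subset_Iic_self (a := (1 : ℝ)))
    have := Real.exp_pos (-(lam * 1))
    linarith

/-- The probability that the path that starts with velocity `a` stays below `β` up to time `t`. -/
def stayProb (lam a b t β : ℝ) : ℝ := (waitingLaw lam).real (staysBelow a b t β)

lemma stayProb_nonneg (lam a b t β : ℝ) : 0 ≤ stayProb lam a b t β := measureReal_nonneg

lemma stayProb_le_one {lam : ℝ} (hlam : 0 < lam) (a b t β : ℝ) : stayProb lam a b t β ≤ 1 := by
  have := isProbabilityMeasure_waitingLaw hlam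
  exact measureReal_le_one

lemma stayProb_eq_one {lam : ℝ} (hlam : 0 < lam) {a b t β : ℝ} (ha : 0 ≤ a) (hab : b ≤ a)
    (hβ : a * t < β) : stayProb lam a b t β = 1 := by
  have := isProbabilityMeasure_waitingLaw hlam
  have h : staysBelow a b t β = Set.univ := by
    refine Set.eq_univ_of_forall fun w s hs => ?_
    exact (zigzag_le hab w hs.1).trans_lt ((mul_le_mul_of_nonneg_left hs.2 ha).trans_lt hβ)
  rw [stayProb, h, probReal_univ]

/-- The factor `exp (lam * t)` turns the exponential density into the same factor at the remaining
time `t - x`, so the rescaled probabilities satisfy the cleaner renewal equations. -/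
lemma exp_mul_integral_Ioc (lam t m : ℝ) (hm : 0 ≤ m) (h : ℝ → ℝ) :
    Real.exp (lam * t) * ∫ x in Set.Ioc 0 m, lam * Real.exp (-(lam * x)) * h x =
      lam * ∫ x in (0 : ℝ)..m, Real.exp (lam * (t - x)) * h x := by
  rw [intervalIntegral.integral_of_le hm, ← integral_const_mul, ← integral_const_mul]
  refine integral_congr_ae (Eventually.of_forall fun x => ?_)
  simp only
  rw [mul_sub, sub_eq_add_neg, Real.exp_add]
  ring

lemma integrableOn_expDensity_mul {lam : ℝ} (hlam : 0 < lam) {h : ℝ → ℝ} (hm : Measurable h)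
    (hb : ∀ x, |h x| ≤ 1) :
    IntegrableOn (fun x => lam * Real.exp (-(lam * x)) * h x) (Set.Ioi 0) := by
  have h1 : IntegrableOn (fun x => lam * Real.exp (-(lam * x))) (Set.Ioi 0) := by
    have := (exp_neg_integrableOn_Ioi 0 hlam).const_mul lam
    simp only [neg_mul] at this
    exact this
  refine Integrable.mono' h1 ?_ (Eventually.of_forall fun x => ?_)
  · exact Measurable.aestronglyMeasurable (by fun_prop)
  · rw [Real.norm_eq_abs, abs_mul, abs_of_nonneg (a := lam * _) (by positivity)]
    exact mul_le_of_le_one_right (by positivity) (hb x)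

/-- Measurability is available for `h`, a section of a measurable set; it passes to `k`, which
agrees with `h` almost everywhere on the interval. -/
lemma intervalIntegrable_exp_mul {lam t m : ℝ} {h k : ℝ → ℝ} (hm : Measurable h)
    (hb : ∀ x, |h x| ≤ 1) (hm0 : 0 ≤ m) (hk : ∀ x ∈ Set.Ioo 0 m, h x = k x) :
    IntervalIntegrable (fun x => Real.exp (lam * (t - x)) * k x) volume 0 m := by
  have h1 : IntervalIntegrable (fun x => Real.exp (lam * (t - x)) * h x) volume 0 m := by
    have hc : Continuous fun x => Real.exp (lam * (t - x)) := by fun_prop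
    refine (hc.intervalIntegrable 0 m).mono_fun
      (Measurable.aestronglyMeasurable (by fun_prop)) (Eventually.of_forall fun x => ?_)
    simp only [norm_mul]
    exact mul_le_of_le_one_right (norm_nonneg _) (hb x)
  refine h1.congr_ae ?_
  rw [Set.uIoc_of_le hm0, ← restrict_Ioo_eq_restrict_Ioc]
  filter_upwards [ae_restrict_mem measurableSet_Ioo] with x hx
  rw [hk x hx]

/-! ### Renewal equations and the uniqueness of their solution. -/

/-- The duration of a downward move after which the level `β` is out of reach. -/
def downTime (c₁ c₂ t β : ℝ) : ℝ := (c₁ * t - β) / (c₁ + c₂)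

/-- The part of `[0, t]` that is left by `downTime`. -/
def upTime (c₁ c₂ t β : ℝ) : ℝ := (c₂ * t + β) / (c₁ + c₂)

section renewal

variable {c₁ c₂ lam : ℝ}

lemma abs_waitingLaw_real_le (hlam : 0 < lam) (B : Set (ℕ → ℝ)) :
    |(waitingLaw lam).real B| ≤ 1 := by
  have := isProbabilityMeasure_waitingLaw hlam
  rw [abs_of_nonneg measureReal_nonneg]
  exact measureReal_le_one

/-- Renewal equation at the first switch, for an upward initial velocity. -/
lemma stayProb_up_eq (hc₁ : 0 < c₁) (hlam : 0 < lam) {t β : ℝ} (hβ : 0 < β) (hβt : β ≤ c₁ * t) :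
    IntervalIntegrable
      (fun a => Real.exp (lam * (t - a)) * stayProb lam (-c₂) c₁ (t - a) (β - c₁ * a))
      volume 0 (β / c₁) ∧
    Real.exp (lam * t) * stayProb lam c₁ (-c₂) t β =
      lam * ∫ a in (0 : ℝ)..(β / c₁),
        Real.exp (lam * (t - a)) * stayProb lam (-c₂) c₁ (t - a) (β - c₁ * a) := by
  have hp := isProbabilityMeasure_expMeasure hlam
  have hm : 0 ≤ β / c₁ := by positivity
  have hmt : β / c₁ ≤ t := (div_le_iff₀ hc₁).2 (by linarith)
  have ht : 0 ≤ t := hm.trans hmt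
  have hB := measurableSet_staysBelow c₁ (-c₂) ht β
  set h : ℝ → ℝ := fun x => (waitingLaw lam).real {w | consSeq x w ∈ staysBelow c₁ (-c₂) t β}
    with hh
  have hmeas : Measurable h := measurable_measureReal_consSeq hB
  have hb : ∀ x, |h x| ≤ 1 := fun x => abs_waitingLaw_real_le hlam _
  have hlow : ∀ x ∈ Set.Ioo 0 (β / c₁),
      h x = stayProb lam (-c₂) c₁ (t - x) (β - c₁ * x) := by
    intro x hx
    refine measureReal_congr (Filter.eventuallyEq_set.2 ?_)
    filter_upwards [ae_admissible_waitingLaw hlam] with w hw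
    have := (lt_div_iff₀ hc₁).1 hx.2
    exact (consSeq_mem_staysBelow_up hw hc₁.le hx.1.le (hx.2.le.trans hmt)).trans
      (and_iff_right (by linarith))
  -- Without a switch by time `β / c₁` the ascending path has already hit `β`.
  have hhigh : ∀ x ∈ Set.Ioi (β / c₁), h x = 0 := by
    intro x hx
    have hx0 : 0 ≤ x := hm.trans (le_of_lt hx)
    have hx' : β < x * c₁ := (div_lt_iff₀ hc₁).1 hx
    refine (measureReal_congr (s := {w | consSeq x w ∈ staysBelow c₁ (-c₂) t β}) (t := ∅)
      (Filter.eventuallyEq_set.2 ?_)).trans measureReal_empty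
    filter_upwards [ae_admissible_waitingLaw hlam] with w hw
    refine iff_of_false (fun hmem => ?_) (Set.notMem_empty _)
    rcases le_or_gt x t with hxt | hxt
    · have := ((consSeq_mem_staysBelow_up hw hc₁.le hx0 hxt).1 hmem).1
      linarith
    · have := (consSeq_mem_staysBelow_up_of_lt hw hc₁.le ht hxt).1 hmem
      linarith
  refine ⟨intervalIntegrable_exp_mul hmeas hb hm hlow, ?_⟩
  have hu : stayProb lam c₁ (-c₂) t β =
      ∫ x in Set.Ioc 0 (β / c₁), lam * Real.exp (-(lam * x)) *
        stayProb lam (-c₂) c₁ (t - x) (β - c₁ * x) := by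
    have h1 : stayProb lam c₁ (-c₂) t β = ∫ x, h x ∂(expMeasure lam) :=
      infinitePi_real_eq_integral hB
    have hi := integrableOn_expDensity_mul hlam hmeas hb
    rw [h1, integral_expMeasure hlam, ← Set.Ioc_union_Ioi_eq_Ioi hm,
      setIntegral_union (Set.Ioc_disjoint_Ioi le_rfl) measurableSet_Ioi
        (hi.mono_set Set.Ioc_subset_Ioi_self) (hi.mono_set (Set.Ioi_subset_Ioi hm)),
      setIntegral_congr_fun (g := fun _ => 0) measurableSet_Ioi
        (fun x hx => by simp only [hhigh x hx, mul_zero]), integral_zero, add_zero,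
      integral_Ioc_eq_integral_Ioo, integral_Ioc_eq_integral_Ioo]
    exact setIntegral_congr_fun measurableSet_Ioo fun x hx => by simp only [hlow x hx]
  rw [hu, exp_mul_integral_Ioc lam t _ hm]

/-- Renewal equation at the first switch, for a downward initial velocity. -/
lemma stayProb_down_eq (hc₁ : 0 < c₁) (hc₂ : 0 < c₂) (hlam : 0 < lam) {t β : ℝ} (hβ : 0 < β)
    (hβt : β ≤ c₁ * t) :
    IntervalIntegrable
      (fun a => Real.exp (lam * (t - a)) * stayProb lam c₁ (-c₂) (t - a) (β + c₂ * a))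
      volume 0 (downTime c₁ c₂ t β) ∧
    Real.exp (lam * t) * stayProb lam (-c₂) c₁ t β =
      lam * (∫ a in (0 : ℝ)..(downTime c₁ c₂ t β),
        Real.exp (lam * (t - a)) * stayProb lam c₁ (-c₂) (t - a) (β + c₂ * a)) +
      Real.exp (lam * upTime c₁ c₂ t β) := by
  have hp := isProbabilityMeasure_expMeasure hlam
  have hpw := isProbabilityMeasure_waitingLaw hlam
  have hcc : 0 < c₁ + c₂ := by positivity
  have ht : 0 ≤ t := by
    by_contra h
    nlinarith
  set m := downTime c₁ c₂ t β
  have hm : 0 ≤ m := div_nonneg (by linarith) hcc.le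
  have hmeq : m * (c₁ + c₂) = c₁ * t - β := div_mul_cancel₀ _ hcc.ne'
  have hmt : m ≤ t := (div_le_iff₀ hcc).2 (by nlinarith)
  have hB := measurableSet_staysBelow (-c₂) c₁ ht β
  set h : ℝ → ℝ := fun x => (waitingLaw lam).real {w | consSeq x w ∈ staysBelow (-c₂) c₁ t β}
    with hh
  have hmeas : Measurable h := measurable_measureReal_consSeq hB
  have hb : ∀ x, |h x| ≤ 1 := fun x => abs_waitingLaw_real_le hlam _
  have hstep : ∀ x, 0 ≤ x → x ≤ t → h x = stayProb lam c₁ (-c₂) (t - x) (β + c₂ * x) := by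
    intro x hx hxt
    refine measureReal_congr (Filter.eventuallyEq_set.2 ?_)
    filter_upwards [ae_admissible_waitingLaw hlam] with w hw
    have := consSeq_mem_staysBelow_down (b := c₁) (t := t) hw (neg_nonpos.2 hc₂.le) hβ hx
    rwa [neg_mul, sub_neg_eq_add] at this
  -- After a descent longer than `m`, even rising for all the remaining time leaves the path below
  -- `β`: `c₁ * (t - x) < β + c₂ * x`.
  have hhigh : ∀ x ∈ Set.Ioi m, h x = 1 := by
    intro x hx
    have hx0 : 0 ≤ x := hm.trans (le_of_lt hx)
    have hx' : m < x := hx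
    rcases le_or_gt x t with hxt | hxt
    · rw [hstep x hx0 hxt]
      exact stayProb_eq_one hlam hc₁.le (by linarith) (by nlinarith)
    · refine (measureReal_congr (s := {w | consSeq x w ∈ staysBelow (-c₂) c₁ t β})
        (t := Set.univ) (Filter.eventuallyEq_set.2 ?_)).trans probReal_univ
      filter_upwards [ae_admissible_waitingLaw hlam] with w hw
      exact iff_of_true (consSeq_mem_staysBelow_down_of_lt hw (neg_nonpos.2 hc₂.le) hβ hxt)
        (Set.mem_univ _)
  have hlow : ∀ x ∈ Set.Ioo 0 m, h x = stayProb lam c₁ (-c₂) (t - x) (β + c₂ * x) :=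
    fun x hx => hstep x hx.1.le (hx.2.le.trans hmt)
  refine ⟨intervalIntegrable_exp_mul hmeas hb hm hlow, ?_⟩
  have htail : ∫ x in Set.Ioi m, lam * Real.exp (-(lam * x)) = Real.exp (-(lam * m)) := by
    have h1 := integral_exp_mul_Ioi (a := -lam) (by linarith) m
    rw [integral_const_mul]
    simp only [neg_mul] at h1
    rw [h1]
    field_simp
  have hu : stayProb lam (-c₂) c₁ t β =
      (∫ x in Set.Ioc 0 m, lam * Real.exp (-(lam * x)) *
        stayProb lam c₁ (-c₂) (t - x) (β + c₂ * x)) + Real.exp (-(lam * m)) := by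
    have h1 : stayProb lam (-c₂) c₁ t β = ∫ x, h x ∂(expMeasure lam) :=
      infinitePi_real_eq_integral hB
    have hi := integrableOn_expDensity_mul hlam hmeas hb
    rw [h1, integral_expMeasure hlam, ← Set.Ioc_union_Ioi_eq_Ioi hm,
      setIntegral_union (Set.Ioc_disjoint_Ioi le_rfl) measurableSet_Ioi
        (hi.mono_set Set.Ioc_subset_Ioi_self) (hi.mono_set (Set.Ioi_subset_Ioi hm)),
      setIntegral_congr_fun (g := fun x => lam * Real.exp (-(lam * x))) measurableSet_Ioi
        (fun x hx => by simp only [hhigh x hx, mul_one]), htail,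
      integral_Ioc_eq_integral_Ioo, integral_Ioc_eq_integral_Ioo]
    congr 1
    exact setIntegral_congr_fun measurableSet_Ioo fun x hx => by simp only [hlow x hx]
  rw [hu, mul_add, exp_mul_integral_Ioc lam t _ hm, ← Real.exp_add]
  congr 2
  have : upTime c₁ c₂ t β = t - m := by
    rw [upTime, div_eq_iff hcc.ne', sub_mul, hmeq]; ring
  rw [this]; ring

/-- The difference between the two sides of the formula, for an upward initial velocity. -/
def upError (c₁ c₂ lam t β : ℝ) : ℝ :=
  Real.exp (lam * t) * stayProb lam c₁ (-c₂) t β -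
    upGF (c₂ / c₁) (lam * downTime c₁ c₂ t β) (lam * upTime c₁ c₂ t β)

/-- The difference between the two sides of the formula, for a downward initial velocity. -/
def downError (c₁ c₂ lam t β : ℝ) : ℝ :=
  Real.exp (lam * t) * stayProb lam (-c₂) c₁ t β -
    downGF (c₂ / c₁) (lam * downTime c₁ c₂ t β) (lam * upTime c₁ c₂ t β)

/-- Integration of ∂U/∂y = λD from the line where `upGF` vanishes; `hm` says that the lower end lies
on it. -/
lemma upGF_eq_integral {ρ : ℝ} (hρ : 0 ≤ ρ) (lam x y m : ℝ) (hm : y - m = ρ * x) :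
    upGF ρ (lam * x) (lam * y) = lam * ∫ a in (0 : ℝ)..m, downGF ρ (lam * x) (lam * (y - a)) := by
  have hd : ∀ a, HasDerivAt (fun a => -upGF ρ (lam * x) (lam * (y - a)))
      (lam * downGF ρ (lam * x) (lam * (y - a))) a := by
    intro a
    have h1 : HasDerivAt (fun a => lam * (y - a)) (lam * (-1)) a :=
      ((hasDerivAt_id a).const_sub y).const_mul lam
    have h2 := ((hasDerivAt_upGF hρ (lam * x) (lam * (y - a))).comp a h1).neg
    refine h2.congr_deriv ?_
    ring
  have hc : Continuous fun a => lam * downGF ρ (lam * x) (lam * (y - a)) :=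
    continuous_const.mul ((continuous_downGF hρ).comp (by fun_prop :
      Continuous fun a : ℝ => (lam * x, lam * (y - a))))
  rw [← intervalIntegral.integral_const_mul,
    intervalIntegral.integral_eq_sub_of_hasDerivAt (fun a _ => hd a) (hc.intervalIntegrable 0 m),
    hm, mul_left_comm, upGF_diag]
  simp

/-- Integration of ∂D/∂x = λU from x = 0, where `downGF` is an exponential. -/
lemma downGF_eq_integral {ρ : ℝ} (hρ : 0 ≤ ρ) (lam x y : ℝ) :
    downGF ρ (lam * x) (lam * y) =
      lam * (∫ a in (0 : ℝ)..x, upGF ρ (lam * (x - a)) (lam * y)) + Real.exp (lam * y) := by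
  have hd : ∀ a, HasDerivAt (fun a => -downGF ρ (lam * (x - a)) (lam * y))
      (lam * upGF ρ (lam * (x - a)) (lam * y)) a := by
    intro a
    have h1 : HasDerivAt (fun a => lam * (x - a)) (lam * (-1)) a :=
      ((hasDerivAt_id a).const_sub x).const_mul lam
    have h2 := ((hasDerivAt_downGF hρ (lam * (x - a)) (lam * y)).comp a h1).neg
    refine h2.congr_deriv ?_
    ring
  have hc : Continuous fun a => lam * upGF ρ (lam * (x - a)) (lam * y) :=
    continuous_const.mul ((continuous_upGF hρ).comp (by fun_prop :
      Continuous fun a : ℝ => (lam * (x - a), lam * y)))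
  rw [← intervalIntegral.integral_const_mul,
    intervalIntegral.integral_eq_sub_of_hasDerivAt (fun a _ => hd a) (hc.intervalIntegrable 0 x),
    sub_self, mul_zero, downGF_zero_left]
  simp

lemma upError_eq_integral (hc₁ : 0 < c₁) (hc₂ : 0 < c₂) (hlam : 0 < lam) {t β : ℝ} (hβ : 0 < β)
    (hβt : β ≤ c₁ * t) :
    upError c₁ c₂ lam t β =
      lam * ∫ a in (0 : ℝ)..(β / c₁), downError c₁ c₂ lam (t - a) (β - c₁ * a) := by
  have hρ : 0 ≤ c₂ / c₁ := by positivity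
  have hcc : c₁ + c₂ ≠ 0 := by positivity
  obtain ⟨hi, he⟩ := stayProb_up_eq (c₂ := c₂) hc₁ hlam hβ hβt
  have hx : ∀ a, downTime c₁ c₂ (t - a) (β - c₁ * a) = downTime c₁ c₂ t β := fun a => by
    rw [downTime, downTime]; congr 1; ring
  have hy : ∀ a, upTime c₁ c₂ (t - a) (β - c₁ * a) = upTime c₁ c₂ t β - a := fun a => by
    rw [upTime, upTime]; field_simp; ring
  have hm : upTime c₁ c₂ t β - β / c₁ = c₂ / c₁ * downTime c₁ c₂ t β := by
    rw [downTime, upTime]; field_simp; ring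
  have hc : Continuous fun a => downGF (c₂ / c₁) (lam * downTime c₁ c₂ t β)
      (lam * (upTime c₁ c₂ t β - a)) :=
    (continuous_downGF hρ).comp (by fun_prop : Continuous fun a : ℝ =>
      (lam * downTime c₁ c₂ t β, lam * (upTime c₁ c₂ t β - a)))
  rw [upError, he, upGF_eq_integral hρ lam _ _ _ hm, ← mul_sub,
    ← intervalIntegral.integral_sub hi (hc.intervalIntegrable _ _)]
  simp only [downError, hx, hy]

/-- The exponential terms of the two renewal equations cancel, which leaves a homogeneous equation.
-/
lemma downError_eq_integral (hc₁ : 0 < c₁) (hc₂ : 0 < c₂) (hlam : 0 < lam) {t β : ℝ}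
    (hβ : 0 < β) (hβt : β ≤ c₁ * t) :
    downError c₁ c₂ lam t β =
      lam * ∫ a in (0 : ℝ)..(downTime c₁ c₂ t β), upError c₁ c₂ lam (t - a) (β + c₂ * a) := by
  have hρ : 0 ≤ c₂ / c₁ := by positivity
  have hcc : c₁ + c₂ ≠ 0 := by positivity
  obtain ⟨hi, he⟩ := stayProb_down_eq hc₁ hc₂ hlam hβ hβt
  have hx : ∀ a, downTime c₁ c₂ (t - a) (β + c₂ * a) = downTime c₁ c₂ t β - a := fun a => by
    rw [downTime, downTime]; field_simp; ring
  have hy : ∀ a, upTime c₁ c₂ (t - a) (β + c₂ * a) = upTime c₁ c₂ t β := fun a => by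
    rw [upTime, upTime]; congr 1; ring
  have hc : Continuous fun a => upGF (c₂ / c₁) (lam * (downTime c₁ c₂ t β - a))
      (lam * upTime c₁ c₂ t β) :=
    (continuous_upGF hρ).comp (by fun_prop : Continuous fun a : ℝ =>
      (lam * (downTime c₁ c₂ t β - a), lam * upTime c₁ c₂ t β))
  rw [downError, he, downGF_eq_integral hρ]
  simp only [upError, hx, hy]
  rw [intervalIntegral.integral_sub hi (hc.intervalIntegrable _ _), mul_sub]
  ring

lemma abs_mul_integral_le_pow_div_factorial (hlam : 0 < lam) {E : ℝ → ℝ} {M m t : ℝ} (n : ℕ)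
    (hM : 0 ≤ M) (hm : 0 ≤ m) (hmt : m ≤ t)
    (hE : ∀ a ∈ Set.Ioo 0 m, |E a| ≤ M * ((lam * (t - a)) ^ n / n.factorial)) :
    |lam * ∫ a in (0 : ℝ)..m, E a| ≤ M * ((lam * t) ^ (n + 1) / (n + 1).factorial) := by
  have hd : ∀ a, HasDerivAt (fun a => -(M * ((lam * (t - a)) ^ (n + 1) / (n + 1).factorial)))
      (lam * (M * ((lam * (t - a)) ^ n / n.factorial))) a := by
    intro a
    have h1 : HasDerivAt (fun a => lam * (t - a)) (lam * (-1)) a :=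
      ((hasDerivAt_id a).const_sub t).const_mul lam
    refine (((h1.pow (n + 1)).div_const _).const_mul M).neg.congr_deriv ?_
    rw [Nat.factorial_succ, Nat.add_sub_cancel]
    push_cast
    field_simp
  have hc : Continuous fun a => lam * (M * ((lam * (t - a)) ^ n / n.factorial)) := by fun_prop
  have hI := intervalIntegral.integral_eq_sub_of_hasDerivAt (fun a _ => hd a)
    (hc.intervalIntegrable 0 m)
  rw [← intervalIntegral.integral_const_mul, ← Real.norm_eq_abs]
  refine (intervalIntegral.norm_integral_le_of_norm_le hm ?_ (hc.intervalIntegrable 0 m)).trans ?_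
  · filter_upwards [compl_mem_ae_iff.2 (measure_singleton (μ := volume) m)] with a ha ha'
    rw [Real.norm_eq_abs, abs_mul, abs_of_pos hlam]
    exact mul_le_mul_of_nonneg_left (hE a ⟨ha'.1, lt_of_le_of_ne ha'.2 ha⟩) hlam.le
  · rw [hI, sub_zero]
    have : 0 ≤ M * ((lam * (t - m)) ^ (n + 1) / (n + 1).factorial) := by
      have := sub_nonneg.2 hmt
      positivity
    linarith

/-- The renewal equations have a unique solution. -/
lemma error_le (hc₁ : 0 < c₁) (hc₂ : 0 < c₂) (hlam : 0 < lam) {T M : ℝ} (hM0 : 0 ≤ M)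
    (hM : ∀ t β, t ≤ T → 0 < β → β ≤ c₁ * t →
      |upError c₁ c₂ lam t β| ≤ M ∧ |downError c₁ c₂ lam t β| ≤ M) (n : ℕ) :
    ∀ t β, t ≤ T → 0 < β → β ≤ c₁ * t →
      |upError c₁ c₂ lam t β| ≤ M * ((lam * t) ^ n / n.factorial) ∧
      |downError c₁ c₂ lam t β| ≤ M * ((lam * t) ^ n / n.factorial) := by
  induction n with
  | zero => simpa using hM
  | succ n ih =>
    intro t β htT hβ hβt
    have hcc : 0 < c₁ + c₂ := by positivity
    have hmt : β / c₁ ≤ t := (div_le_iff₀ hc₁).2 (by linarith)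
    have ht : 0 ≤ t := le_trans (by positivity) hmt
    refine ⟨?_, ?_⟩
    · rw [upError_eq_integral hc₁ hc₂ hlam hβ hβt]
      refine abs_mul_integral_le_pow_div_factorial hlam n hM0 (by positivity) hmt fun a ha => ?_
      -- The point after the switch remains in the region `0 < β ≤ c₁ * t`, so the induction
      -- hypothesis applies.
      have := (lt_div_iff₀ hc₁).1 ha.2
      exact (ih (t - a) (β - c₁ * a) (by linarith [ha.1]) (by linarith)
        (by linarith)).2
    · rw [downError_eq_integral hc₁ hc₂ hlam hβ hβt]
      have hx : downTime c₁ c₂ t β * (c₁ + c₂) = c₁ * t - β := div_mul_cancel₀ _ hcc.ne'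
      have hx0 : 0 ≤ downTime c₁ c₂ t β := div_nonneg (by linarith) hcc.le
      refine abs_mul_integral_le_pow_div_factorial hlam n hM0 hx0
        ((div_le_iff₀ hcc).2 (by nlinarith)) fun a ha => ?_
      have h1 := mul_pos hc₂ ha.1
      have h2 := mul_lt_mul_of_pos_right ha.2 hcc
      exact (ih (t - a) (β + c₂ * a) (by linarith [ha.1]) (by linarith) (by linarith)).1

/-- Probabilities are at most 1, and the continuous generating functions are bounded on a compact
square containing all arguments, because `downTime` and `upTime` are nonnegative with sum `t`. -/
lemma exists_error_bound (hc₁ : 0 < c₁) (hc₂ : 0 < c₂) (hlam : 0 < lam) (T : ℝ) :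
    ∃ M, 0 ≤ M ∧ ∀ t β, t ≤ T → 0 < β → β ≤ c₁ * t →
      |upError c₁ c₂ lam t β| ≤ M ∧ |downError c₁ c₂ lam t β| ≤ M := by
  have hρ : 0 ≤ c₂ / c₁ := by positivity
  have hK : IsCompact (Set.Icc (0 : ℝ) (lam * T) ×ˢ Set.Icc (0 : ℝ) (lam * T)) :=
    isCompact_Icc.prod isCompact_Icc
  obtain ⟨A, hA⟩ := hK.exists_bound_of_continuousOn (continuous_upGF hρ).continuousOn
  obtain ⟨B, hB⟩ := hK.exists_bound_of_continuousOn (continuous_downGF hρ).continuousOn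
  refine ⟨Real.exp (lam * T) + (|A| + |B|), by positivity, fun t β htT hβ hβt => ?_⟩
  have hcc : 0 < c₁ + c₂ := by positivity
  have ht : 0 ≤ t := by
    by_contra h
    nlinarith
  have hx0 : 0 ≤ downTime c₁ c₂ t β := div_nonneg (by linarith) hcc.le
  have hy0 : 0 ≤ upTime c₁ c₂ t β := div_nonneg (by positivity) hcc.le
  have hxy : downTime c₁ c₂ t β + upTime c₁ c₂ t β = t := by
    rw [downTime, upTime]; field_simp; ring
  have hmem : (lam * downTime c₁ c₂ t β, lam * upTime c₁ c₂ t β) ∈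
      Set.Icc (0 : ℝ) (lam * T) ×ˢ Set.Icc (0 : ℝ) (lam * T) :=
    ⟨⟨by positivity, mul_le_mul_of_nonneg_left (by linarith) hlam.le⟩,
      ⟨by positivity, mul_le_mul_of_nonneg_left (by linarith) hlam.le⟩⟩
  have hu : ∀ a b, |Real.exp (lam * t) * stayProb lam a b t β| ≤ Real.exp (lam * T) := by
    intro a b
    rw [abs_mul, Real.abs_exp, abs_of_nonneg (stayProb_nonneg _ _ _ _ _)]
    refine (mul_le_of_le_one_right (Real.exp_pos _).le (stayProb_le_one hlam _ _ _ _)).trans ?_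
    exact Real.exp_le_exp.2 (mul_le_mul_of_nonneg_left htT hlam.le)
  have h1 := hA _ hmem
  have h2 := hB _ hmem
  rw [Real.norm_eq_abs] at h1 h2
  constructor
  · refine (abs_sub _ _).trans (add_le_add (hu _ _) ?_)
    linarith [le_abs_self A, abs_nonneg B]
  · refine (abs_sub _ _).trans (add_le_add (hu _ _) ?_)
    linarith [le_abs_self B, abs_nonneg A]

/-- The probability that an initially upward path stays below a positive level. -/
lemma stayProb_up_eq_upGF (hc₁ : 0 < c₁) (hc₂ : 0 < c₂) (hlam : 0 < lam) {t β : ℝ}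
    (hβ : 0 ≤ β) (hβt : β ≤ c₁ * t) (ht : 0 ≤ t) :
    stayProb lam c₁ (-c₂) t β = Real.exp (-(lam * t)) *
      upGF (c₂ / c₁) (lam * downTime c₁ c₂ t β) (lam * upTime c₁ c₂ t β) := by
  rcases hβ.eq_or_lt with rfl | hβ
  -- The path starts at 0, so it cannot stay below level 0; correspondingly the arguments of `upGF`
  -- lie on its zero line.
  · have h1 : staysBelow c₁ (-c₂) t 0 = ∅ := by
      refine Set.eq_empty_of_forall_notMem fun w hw => ?_
      simpa using hw 0 ⟨le_rfl, ht⟩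
    have h2 : lam * upTime c₁ c₂ t 0 = c₂ / c₁ * (lam * downTime c₁ c₂ t 0) := by
      rw [upTime, downTime]; field_simp; ring
    rw [stayProb, h1, measureReal_empty, h2, upGF_diag, mul_zero]
  · obtain ⟨M, hM0, hM⟩ := exists_error_bound hc₁ hc₂ hlam t
    have hzero : upError c₁ c₂ lam t β = 0 := by
      have hlim : Tendsto (fun n : ℕ => M * ((lam * t) ^ n / n.factorial)) atTop (𝓝 0) := by
        simpa using (FloorSemiring.tendsto_pow_div_factorial_atTop (lam * t)).const_mul M
      exact abs_nonpos_iff.1 (ge_of_tendsto' hlim fun n =>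
        (error_le hc₁ hc₂ hlam hM0 hM n t β le_rfl hβ hβt).1)
    rw [upError, sub_eq_zero] at hzero
    rw [← hzero, ← mul_assoc, ← Real.exp_add, neg_add_cancel, Real.exp_zero, one_mul]

end renewal

/-! ### The Bessel form, and transfer to the random process. -/

lemma hasSum_besselTerm {c₁ c₂ lam t β : ℝ} (hc₁ : 0 < c₁) (hc₂ : 0 < c₂) (hlam : 0 < lam)
    (ht : 0 < t) (hβ : 0 ≤ β) (hβt : β < c₁ * t) :
    HasSum (fun n : ℕ => besselTerm c₁ c₂ lam t β (n + 1))
      (upGF (c₂ / c₁) (lam * downTime c₁ c₂ t β) (lam * upTime c₁ c₂ t β)) := by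
  have hcc : 0 < c₁ + c₂ := by positivity
  have hp : 0 < c₁ * t - β := by linarith
  have hq : 0 < c₂ * t + β := by positivity
  have hx : 0 < lam * downTime c₁ c₂ t β := mul_pos hlam (div_pos hp hcc)
  have hy : 0 < lam * upTime c₁ c₂ t β := mul_pos hlam (div_pos hq hcc)
  have h := hasSum_besselI (ρ := c₂ / c₁) (by positivity) (Real.sqrt_pos.2 hx) (Real.sqrt_pos.2 hy)
  rw [Real.sq_sqrt hx.le, Real.sq_sqrt hy.le] at h
  have h1 : 2 * lam / (c₁ + c₂) * √((c₁ * t - β) * (c₂ * t + β)) =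
      2 * (√(lam * downTime c₁ c₂ t β) * √(lam * upTime c₁ c₂ t β)) := by
    have h2 : lam * downTime c₁ c₂ t β * (lam * upTime c₁ c₂ t β) =
        (lam / (c₁ + c₂)) ^ 2 * ((c₁ * t - β) * (c₂ * t + β)) := by
      rw [downTime, upTime]; ring
    rw [← Real.sqrt_mul hx.le, h2, Real.sqrt_mul (sq_nonneg (lam / (c₁ + c₂))), Real.sqrt_sq (by positivity)]
    ring
  have h3 : √((c₂ * t + β) / (c₁ * t - β)) =
      √(lam * upTime c₁ c₂ t β) / √(lam * downTime c₁ c₂ t β) := by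
    rw [← Real.sqrt_div hy.le, downTime, upTime]
    congr 1
    field_simp
  have h4 : √((c₁ * t - β) / (c₂ * t + β)) =
      √(lam * downTime c₁ c₂ t β) / √(lam * upTime c₁ c₂ t β) := by
    rw [← Real.sqrt_div hx.le, downTime, upTime]
    congr 1
    field_simp
  simpa only [besselTerm, h1, h3, h4] using h

section process

variable {Ω : Type*} {c₁ c₂ : ℝ} {V₀ : Ω → ℝ} {W : ℕ → Ω → ℝ} {t : ℝ} {ω : Ω}

lemma position_eq_zigzag (hω : V₀ ω = c₁) :
    (fun s => position c₁ c₂ V₀ W s ω) = zigzag c₁ (-c₂) fun n => W n ω := by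
  funext s
  refine intervalIntegral.integral_congr fun u _ => ?_
  simp only [velocity, hω, if_true]
  rfl

lemma runningMax_lt_iff (ht : 0 ≤ t) (hω : V₀ ω = c₁) (β : ℝ) :
    runningMax c₁ c₂ V₀ W t ω < β ↔ (fun n => W n ω) ∈ staysBelow c₁ (-c₂) t β := by
  rw [runningMax, position_eq_zigzag hω, isCompact_Icc.sSup_lt_iff_of_continuous
    (Set.nonempty_Icc.2 ht) (continuous_zigzag _ _ _).continuousOn]
  rfl

lemma runningMax_le (hc₁ : 0 ≤ c₁) (hc₂ : 0 ≤ c₂) (ht : 0 ≤ t) (hω : V₀ ω = c₁) :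
    runningMax c₁ c₂ V₀ W t ω ≤ c₁ * t := by
  rw [runningMax, position_eq_zigzag hω]
  refine csSup_le ((Set.nonempty_Icc.2 ht).image _) ?_
  rintro _ ⟨s, hs, rfl⟩
  exact (zigzag_le (by linarith) _ hs.1).trans (mul_le_mul_of_nonneg_left hs.2 hc₁)

variable [MeasurableSpace Ω] {P : Measure Ω} {lam : ℝ}

lemma IsTelegraph.map_waiting (hT : IsTelegraph P c₁ c₂ lam V₀ W) :
    P.map (fun ω n => W n ω) = waitingLaw lam := by
  rw [hT.waiting.indep.map_fun_eq_infinitePi_map hT.waiting.measurable, waitingLaw]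
  simp only [hT.waiting.law]

lemma IsTelegraph.measurableSet_pos (hT : IsTelegraph P c₁ c₂ lam V₀ W) :
    MeasurableSet {ω | V₀ ω = c₁} :=
  hT.measurable_V₀ (measurableSet_singleton c₁)

/-- Given the initial velocity, the waiting times keep their law. -/
lemma IsTelegraph.cond_real_preimage (hT : IsTelegraph P c₁ c₂ lam V₀ W) {B : Set (ℕ → ℝ)}
    (hB : MeasurableSet B) :
    (P[|{ω | V₀ ω = c₁}]).real ((fun ω n => W n ω) ⁻¹' B) = (waitingLaw lam).real B := by
  have hW : Measurable fun ω n => W n ω := measurable_pi_iff.2 hT.waiting.measurable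
  have hind := hT.indep.measure_inter_preimage_eq_mul {c₁} B (measurableSet_singleton c₁) hB
  have h0 : V₀ ⁻¹' {c₁} = {ω | V₀ ω = c₁} := rfl
  rw [h0, hT.prob_pos] at hind
  rw [measureReal_def, cond_apply hT.measurableSet_pos, hind, hT.prob_pos, ← mul_assoc,
    ENNReal.inv_mul_cancel (by simp) (by simp), one_mul, ← hT.map_waiting, measureReal_def,
    Measure.map_apply hW hB]

lemma IsTelegraph.ae_cond (hT : IsTelegraph P c₁ c₂ lam V₀ W) :
    ∀ᵐ ω ∂(P[|{ω | V₀ ω = c₁}]), V₀ ω = c₁ :=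
  ae_cond_mem hT.measurableSet_pos

lemma IsTelegraph.cond_real_runningMax_lt (hT : IsTelegraph P c₁ c₂ lam V₀ W) (ht : 0 ≤ t)
    (β : ℝ) :
    (P[|{ω | V₀ ω = c₁}]).real {ω | runningMax c₁ c₂ V₀ W t ω < β} =
      stayProb lam c₁ (-c₂) t β := by
  rw [stayProb, ← hT.cond_real_preimage (measurableSet_staysBelow _ _ ht β)]
  refine measureReal_congr (Filter.eventuallyEq_set.2 ?_)
  filter_upwards [hT.ae_cond] with ω hω
  exact runningMax_lt_iff ht hω β

/-- The maximum never exceeds `c₁ * t`, so equality is the complement of strict inequality. -/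
lemma IsTelegraph.cond_real_runningMax_eq (hT : IsTelegraph P c₁ c₂ lam V₀ W) (hc₁ : 0 ≤ c₁)
    (hc₂ : 0 ≤ c₂) (hlam : 0 < lam) (ht : 0 ≤ t) :
    (P[|{ω | V₀ ω = c₁}]).real {ω | runningMax c₁ c₂ V₀ W t ω = c₁ * t} =
      1 - stayProb lam c₁ (-c₂) t (c₁ * t) := by
  have := isProbabilityMeasure_waitingLaw hlam
  have hB := measurableSet_staysBelow c₁ (-c₂) ht (c₁ * t)
  rw [stayProb, ← probReal_compl_eq_one_sub hB, ← hT.cond_real_preimage hB.compl]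
  refine measureReal_congr (Filter.eventuallyEq_set.2 ?_)
  filter_upwards [hT.ae_cond] with ω hω
  rw [Set.mem_preimage, Set.mem_compl_iff, ← runningMax_lt_iff ht hω, not_lt]
  exact ⟨fun h => h.ge, fun h => (runningMax_le hc₁ hc₂ ht hω).antisymm h⟩

end process

end Telegraph

end

theorem theorem2p3 {Ω : Type*} [MeasurableSpace Ω] (P : Measure Ω) [IsProbabilityMeasure P]
    (c₁ c₂ lam t : ℝ) (hc₁ : 0 < c₁) (hc₂ : 0 < c₂) (hlam : 0 < lam) (ht : 0 < t)
    (V₀ : Ω → ℝ) (W : ℕ → Ω → ℝ) (hT : Telegraph.IsTelegraph P c₁ c₂ lam V₀ W) :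
    -- the law of the maximum below `c₁ t`, the series running over `r = n + 1 ≥ 1`
    (∀ β : ℝ, 0 ≤ β → β < c₁ * t →
      Summable (fun n : ℕ => Telegraph.besselTerm c₁ c₂ lam t β (n + 1)) ∧
      (P[|{ω | V₀ ω = c₁}]).real {ω | Telegraph.runningMax c₁ c₂ V₀ W t ω < β} =
        Real.exp (-(lam * t)) * ∑' n : ℕ, Telegraph.besselTerm c₁ c₂ lam t β (n + 1)) ∧
    -- at `β = c₁ t`, where the formula has to be read as its limit from the left
    (Tendsto (fun β : ℝ => Real.exp (-(lam * t)) *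
        ∑' n : ℕ, Telegraph.besselTerm c₁ c₂ lam t β (n + 1)) (𝓝[<] (c₁ * t))
      (𝓝 ((P[|{ω | V₀ ω = c₁}]).real
        {ω | Telegraph.runningMax c₁ c₂ V₀ W t ω < c₁ * t})) ∧
      (P[|{ω | V₀ ω = c₁}]).real {ω | Telegraph.runningMax c₁ c₂ V₀ W t ω < c₁ * t} =
        1 - Real.exp (-(lam * t))) ∧
    -- the atom at `c₁ t`
    (P[|{ω | V₀ ω = c₁}]).real {ω | Telegraph.runningMax c₁ c₂ V₀ W t ω = c₁ * t} =
      Real.exp (-(lam * t)) := by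
  have hval : Telegraph.stayProb lam c₁ (-c₂) t (c₁ * t) = 1 - Real.exp (-(lam * t)) := by
    have hx : lam * Telegraph.downTime c₁ c₂ t (c₁ * t) = 0 := by simp [Telegraph.downTime]
    have hy : lam * Telegraph.upTime c₁ c₂ t (c₁ * t) = lam * t := by
      rw [Telegraph.upTime]; field_simp; ring
    rw [Telegraph.stayProb_up_eq_upGF hc₁ hc₂ hlam (by positivity) le_rfl ht.le, hx, hy,
      Telegraph.upGF_zero_left (by positivity), mul_sub, ← Real.exp_add, neg_add_cancel,
      Real.exp_zero, mul_one]
  refine ⟨fun β hβ hβt => ?_, ⟨?_, ?_⟩, ?_⟩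
  · have h := Telegraph.hasSum_besselTerm hc₁ hc₂ hlam ht hβ hβt
    refine ⟨h.summable, ?_⟩
    rw [hT.cond_real_runningMax_lt ht.le, h.tsum_eq,
      Telegraph.stayProb_up_eq_upGF hc₁ hc₂ hlam hβ hβt.le ht.le]
  · rw [hT.cond_real_runningMax_lt ht.le,
      Telegraph.stayProb_up_eq_upGF hc₁ hc₂ hlam (by positivity) le_rfl ht.le]
    have hc : Continuous fun β => Real.exp (-(lam * t)) * Telegraph.upGF (c₂ / c₁)
        (lam * Telegraph.downTime c₁ c₂ t β) (lam * Telegraph.upTime c₁ c₂ t β) := by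
      refine continuous_const.mul ((Telegraph.continuous_upGF (by positivity)).comp
        (g := fun q : ℝ × ℝ => Telegraph.upGF (c₂ / c₁) q.1 q.2) (f := fun β : ℝ =>
          (lam * Telegraph.downTime c₁ c₂ t β, lam * Telegraph.upTime c₁ c₂ t β)) ?_)
      unfold Telegraph.downTime Telegraph.upTime
      fun_prop
    -- The closed form is continuous up to `c₁ * t`, whereas the Bessel terms divide by `c₁ * t -
    -- β`; the two are identified only for `β < c₁ * t`.
    refine (hc.continuousWithinAt (s := Set.Iio (c₁ * t)) (x := c₁ * t)).congr' ?_
    have hpos : ∀ᶠ β in 𝓝[<] (c₁ * t), 0 < β :=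
      nhdsWithin_le_nhds (lt_mem_nhds (by positivity))
    filter_upwards [self_mem_nhdsWithin, hpos] with β hβt hβ
    rw [(Telegraph.hasSum_besselTerm hc₁ hc₂ hlam ht hβ.le hβt).tsum_eq]
  · rw [hT.cond_real_runningMax_lt ht.le, hval]
  · rw [hT.cond_real_runningMax_eq hc₁.le hc₂.le hlam ht.le, hval, sub_sub_cancel]
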